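/- **Setting.** Let $(V,Y,\mathbf 1,\omega)$ be a vertex operator algebra over $\mathbb C$ ($\mathbb Z$-graded, $V=\bigoplus_{n}V_{(n)}$, with $\dim V_{(n)}<\infty$ and $V_{(n)}=0$ for $n\ll 0$). Let $g_1,g_2$ be commuting automorphisms of $V$ of finite orders $T_1,T_2$, and let $g_3=g_1g_2$, of order $T_3$. For an automorphism $g$ of finite order $T$ put $V^{(g,r)}=\{v\in V : gv=e^{-2\pi i r/T}v\}$, and put $V^{(r_1,r_2)}=V^{(g_1,r_1)}\cap V^{(g_2,r_2)}$. A *weak $g$-twisted $V$-module* is a vector space $W$ with a linear map $v\mapsto Y_W(v,x)=\sum_{q\in\frac1T\mathbb Z}v_qx^{-q-1}$ from $V$ to $\operatorname{End}(W)[[x^{1/T},x^{-1/T}]]$ such that $Y_W(\mathbf 1,x)=\mathrm{id}_W$; $Y_W(u,x)w\in x^{r/T}W((x))$ for $u\in V^{(g,r)}$, $w\in W$, $0\le r<T$; and, for $v\in V^{(g,r)}$, $0\le r<T$, and $u\in V$, $$x_0^{-1}\delta\Big(\frac{x_1-x_2}{x_0}\Big)Y_W(v,x_1)Y_W(u,x_2)-x_0^{-1}\delta\Big(\frac{x_2-x_1}{-x_0}\Big)Y_W(u,x_2)Y_W(v,x_1)=x_1^{-1}\delta\Big(\frac{x_2+x_0}{x_1}\Big)\Big(\frac{x_2+x_0}{x_1}\Big)^{-r/T}Y_W(Y(v,x_0)u,x_2).$$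 Put $L(n)=\omega_{n+1}$. The module is a *generalized $g$-twisted $V$-module* if $W=\bigoplus_{\lambda\in\mathbb C}W_{(\lambda)}$, where $W_{(\lambda)}$ is the generalized $\lambda$-eigenspace of $L(0)$, and if for every $\lambda$ one has $W_{(\lambda+n/T)}=0$ for all sufficiently negative integers $n$. Submodules are the subspaces stable under all $v_q$; simplicity and finite composition length are meant with respect to these. The subspace $C_1(W)$ is spanned by all $v_{-1}w$ with $v\in V^{(g,0)}$ homogeneous of weight $>0$ and $w\in W$, and all $v_{-1-r/T}w$ with $1\le r\le T-1$, $v\in V^{(g,r)}$ homogeneous of weight $\ge 0$ and $w\in W$; $W$ is *$C_1$-cofinite* if $\dim W/C_1(W)<\infty$. For generalized $g_k$-twisted $V$-modules $W^k$ ($k=1,2,3$), a *twisted logarithmic intertwining operator* of type $\binom{W^3}{W^1\;W^2}$ is a linear map $$\mathcal Y:W^1\otimes W^2\to W^3[\log x]\{x\},\qquad \mathcal Y(w^1,x)w^2=\sum_{h\in\mathbb C}\sum_{k\in\mathbb N}w^1_{h;k}w^2\,x^{-h-1}(\log x)^k$$ (for each $h$ only finitely many $k$ contribute) such that: * for all $w^1,w^2$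 and $h\in\mathbb C$, $w^1_{h+n;k}w^2=0$ for all sufficiently large $n\in\mathbb N$, independently of $k$; * for $v\in V^{(r_1,r_2)}$, $0\le r_1<T_1$, $0\le r_2<T_2$, $w^1\in W^1$, $w^2\in W^2$, $$\begin{aligned}&x_0^{-1}\delta\Big(\frac{x_1-x_2}{x_0}\Big)\Big(\frac{x_1-x_2}{x_0}\Big)^{-r_1/T_1}Y_{W^3}(v,x_1)\mathcal Y(w^1,x_2)w^2\\&-x_0^{-1}\delta\Big(\frac{-x_2+x_1}{x_0}\Big)\Big(\frac{-x_2+x_1}{x_0}\Big)^{-r_1/T_1}\mathcal Y(w^1,x_2)Y_{W^2}(v,x_1)w^2\\&=x_1^{-1}\delta\Big(\frac{x_2+x_0}{x_1}\Big)\Big(\frac{x_2+x_0}{x_1}\Big)^{-r_2/T_2}\mathcal Y(Y_{W^1}(v,x_0)w^1,x_2)w^2,\end{aligned}$$ where $(-x)^\alpha$ means $e^{\pi i\alpha}x^\alpha$ and binomials are expanded in nonnegative integer powers of the second variable; * $\mathcal Y(L(-1)w^1,x)=\frac{d}{dx}\mathcal Y(w^1,x)$. **Theorem.** Let $W^1$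 and $W^2$ be $C_1$-cofinite generalized $g_1$- and $g_2$-twisted $V$-modules, and let $W^3$ be a generalized $g_3$-twisted $V$-module of finite composition length. Then the vector space of twisted logarithmic intertwining operators of type $\binom{W^3}{W^1\;W^2}$ is finite-dimensional. If moreover $W^3$ is simple, its dimension is at most $\dim\big(W^1/C_1(W^1)\big)\cdot\dim\big(W^2/C_1(W^2)\big)$. -/

import Mathlib

open Module

noncomputable section

/-- A vertex operator algebra `(V, Y, 𝟏, ω)` over `ℂ`.  The vertex operator
`Y(v, x) = ∑ v_n x^{-n-1}` is given by its modes `v_n = Y v n`; in particular `L(n) = ω_{n+1}`.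
The homogeneous subspace `V_(n)` is the eigenspace of `L(0) = ω_1` for the eigenvalue `n`. -/
structure VertexOperatorAlgebra (V : Type*) [AddCommGroup V] [Module ℂ V] where
  /-- The modes `v_n`. -/
  Y : V →ₗ[ℂ] (ℤ → Module.End ℂ V)
  /-- The vacuum vector. -/
  vac : V
  /-- The conformal vector. -/
  ω : V
  /-- The central charge. -/
  c : ℂ
  truncation : ∀ u v : V, ∃ N : ℤ, ∀ n ≥ N, Y u n v = 0
  vacuum : ∀ n : ℤ, Y vac n = if n = -1 then 1 else 0
  creation : ∀ v : V, Y v (-1) vac = v ∧ ∀ n ≥ (0 : ℤ), Y v n vac = 0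
  /-- The Jacobi identity: the coefficient of `x₀^{-n-1} x₁^{-m-1} x₂^{-q-1}`.  All sums are
  finite by `truncation`. -/
  jacobi : ∀ (u v w : V) (n m q : ℤ),
    (∑ᶠ i : ℕ, ((-1 : ℂ) ^ i * Ring.choose (n : ℂ) i) • Y u (n + m - i) (Y v (q + i) w))
      - (∑ᶠ i : ℕ, ((-1 : ℂ) ^ (n - (i : ℤ)) * Ring.choose (n : ℂ) i) •
          Y v (q + n - i) (Y u (m + i) w))
      = ∑ᶠ i : ℕ, Ring.choose (m : ℂ) i • Y (Y u (n + i) v) (q + m - i) w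
  virasoro : ∀ m n : ℤ,
    Y ω (m + 1) * Y ω (n + 1) - Y ω (n + 1) * Y ω (m + 1)
      = ((m : ℂ) - n) • Y ω (m + n + 1)
        + if m + n = 0 then (((m : ℂ) ^ 3 - m) / 12 * c) • (1 : Module.End ℂ V) else 0
  /-- The `L(-1)`-derivative property `Y(L(-1)v, x) = d/dx Y(v, x)`. -/
  derivative : ∀ (v : V) (n : ℤ), Y (Y ω 0 v) n = (-(n : ℂ)) • Y v (n - 1)
  grading : DirectSum.IsInternal fun n : ℤ => Module.End.eigenspace (Y ω 1) (n : ℂ)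
  grading_finite : ∀ n : ℤ, FiniteDimensional ℂ (Module.End.eigenspace (Y ω 1) (n : ℂ))
  grading_bounded : ∃ N : ℤ, ∀ n < N, Module.End.eigenspace (Y ω 1) (n : ℂ) = ⊥

namespace VertexOperatorAlgebra

variable {V : Type*} [AddCommGroup V] [Module ℂ V] (A : VertexOperatorAlgebra V)

/-- The homogeneous subspace `V_(n)` of weight `n`. -/
def wt (n : ℤ) : Submodule ℂ V := Module.End.eigenspace (A.Y A.ω 1) (n : ℂ)

/-- The group of automorphisms of a vertex operator algebra: the linear automorphisms `g` with
`g 𝟏 = 𝟏`, `g ω = ω` and `g (u_n v) = (g u)_n (g v)`. -/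
def Aut : Subgroup (V ≃ₗ[ℂ] V) where
  carrier := {g | g A.vac = A.vac ∧ g A.ω = A.ω ∧
    ∀ (u v : V) (n : ℤ), g (A.Y u n v) = A.Y (g u) n (g v)}
  one_mem' := ⟨rfl, rfl, fun _ _ _ => rfl⟩
  mul_mem' := by
    rintro a b ⟨ha, ha', ha''⟩ ⟨hb, hb', hb''⟩
    refine ⟨?_, ?_, ?_⟩ <;> simp_all [LinearEquiv.mul_apply]
  inv_mem' := by
    rintro a ⟨ha, ha', ha''⟩
    refine ⟨?_, ?_, fun u v n => ?_⟩
    · exact a.symm_apply_eq.2 ha.symm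
    · exact a.symm_apply_eq.2 ha'.symm
    · refine a.symm_apply_eq.2 ?_
      rw [ha'']
      change _ = A.Y (a (a.symm u)) n (a (a.symm v))
      simp

variable {A}

/-- The eigenspace `V^{(g, r)} = {v | g v = e^{-2πi r/T} v}`, where `T` is the order of `g`. -/
def sector (g : A.Aut) (r : ℕ) : Submodule ℂ V :=
  Module.End.eigenspace ((g : V ≃ₗ[ℂ] V) : V →ₗ[ℂ] V)
    (Complex.exp (-(2 * Real.pi * Complex.I * r / orderOf g)))

end VertexOperatorAlgebra

/-- A weak `g`-twisted `V`-module structure on `W`, for an automorphism `g` of finite order `T`.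
The operator `Y_W(v, x) = ∑ v_q x^{-q-1}` is given by its modes `v_q = Y v q`, indexed by rational
`q`; by `twisted`, only the modes with `q ∈ (1/T)ℤ` can be nonzero. -/
structure WeakTwistedModule {V : Type*} [AddCommGroup V] [Module ℂ V]
    (A : VertexOperatorAlgebra V) (g : A.Aut) (W : Type*) [AddCommGroup W] [Module ℂ W] where
  /-- The modes `v_q` acting on `W`. -/
  Y : V →ₗ[ℂ] (ℚ → Module.End ℂ W)
  vacuum : ∀ q : ℚ, Y A.vac q = if q = -1 then 1 else 0
  /-- For `u ∈ V^{(g, r)}`, the series `Y_W(u, x) w` lies in `x^{r/T} W((x))`. -/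
  twisted : ∀ r < orderOf g, ∀ u ∈ VertexOperatorAlgebra.sector g r, ∀ w : W,
    (∀ q : ℚ, (¬ ∃ n : ℤ, q = n - (r : ℚ) / orderOf g) → Y u q w = 0) ∧
      ∃ N : ℚ, ∀ q ≥ N, Y u q w = 0
  /-- The twisted Jacobi identity for `v ∈ V^{(g, r)}` and `u ∈ V`: the coefficient of
  `x₀^{-n-1} x₁^{-b-1} x₂^{-q-1}`, where `b = m - r/T`.  The `x₁`-exponents of all three terms
  lie in `r/T + ℤ`, so that these are all the coefficients. -/
  jacobi : ∀ r < orderOf g, ∀ v ∈ VertexOperatorAlgebra.sector g r, ∀ (u : V) (w : W)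
    (n m : ℤ) (q b : ℚ), b = m - (r : ℚ) / orderOf g →
    (∑ᶠ i : ℕ, ((-1 : ℂ) ^ i * Ring.choose (n : ℂ) i) • Y v (n + b - i) (Y u (q + i) w))
      - (∑ᶠ i : ℕ, ((-1 : ℂ) ^ (n - (i : ℤ)) * Ring.choose (n : ℂ) i) •
          Y u (q + n - i) (Y v (b + i) w))
      = ∑ᶠ i : ℕ, Ring.choose (b : ℂ) i • Y (A.Y v (n + i) u) (q + b - i) w

namespace WeakTwistedModule

variable {V : Type*} [AddCommGroup V] [Module ℂ V] {A : VertexOperatorAlgebra V} {g : A.Aut}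
  {W : Type*} [AddCommGroup W] [Module ℂ W] (M : WeakTwistedModule A g W)

/-- The operator `L(n) = ω_{n+1}` on `W`. -/
def L (n : ℤ) : Module.End ℂ W := M.Y A.ω (n + 1)

/-- The generalized eigenspace `W_(μ)` of `L(0)`. -/
def weightSpace (μ : ℂ) : Submodule ℂ W := (M.L 0).maxGenEigenspace μ

/-- `W` is a generalized `g`-twisted module: it is the direct sum of its weight spaces, and for
every `μ` the weight spaces `W_(μ + n/T)` vanish for all sufficiently negative integers `n`. -/
def IsGeneralized : Prop :=
  DirectSum.IsInternal M.weightSpace ∧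
    ∀ μ : ℂ, ∃ N : ℤ, ∀ n ≤ N, M.weightSpace (μ + n / orderOf g) = ⊥

/-- The subspace `C₁(W)`. -/
def C₁ : Submodule ℂ W :=
  Submodule.span ℂ {x | ∃ v ∈ VertexOperatorAlgebra.sector g 0, ∃ n > (0 : ℤ), v ∈ A.wt n ∧
      ∃ w : W, x = M.Y v (-1) w} ⊔
  Submodule.span ℂ {x | ∃ r : ℕ, 1 ≤ r ∧ r < orderOf g ∧
      ∃ v ∈ VertexOperatorAlgebra.sector g r, ∃ n ≥ (0 : ℤ), v ∈ A.wt n ∧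
      ∃ w : W, x = M.Y v (-1 - (r : ℚ) / orderOf g) w}

/-- `W` is `C₁`-cofinite. -/
def IsC₁Cofinite : Prop := FiniteDimensional ℂ (W ⧸ M.C₁)

/-- A subspace is a (twisted) submodule if it is stable under all modes. -/
def IsSubmodule (S : Submodule ℂ W) : Prop :=
  ∀ (v : V) (q : ℚ), ∀ w ∈ S, M.Y v q w ∈ S

/-- `W` is simple: it is nonzero and its only submodules are `0` and `W`. -/
def IsSimple : Prop :=
  Nontrivial W ∧ ∀ S : Submodule ℂ W, M.IsSubmodule S → S = ⊥ ∨ S = ⊤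

/-- `W` has finite composition length: there is a finite chain of submodules from `0` to `W` in
which no submodule can be inserted, that is, whose successive quotients are simple. -/
def HasFiniteLength : Prop :=
  ∃ (n : ℕ) (S : Fin (n + 1) → {S : Submodule ℂ W // M.IsSubmodule S}),
    (S 0).1 = ⊥ ∧ (S (Fin.last n)).1 = ⊤ ∧ ∀ i : Fin n, S i.castSucc ⋖ S i.succ

end WeakTwistedModule

section Intertwining

variable {V : Type*} [AddCommGroup V] [Module ℂ V] {A : VertexOperatorAlgebra V} {g₁ g₂ : A.Aut}
  {W₁ W₂ W₃ : Type*} [AddCommGroup W₁] [Module ℂ W₁] [AddCommGroup W₂] [Module ℂ W₂]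
  [AddCommGroup W₃] [Module ℂ W₃]

/-- Twisted logarithmic intertwining operators of type `(W₃ ; W₁ W₂)`, where `W₁`, `W₂` and `W₃` are
twisted by `g₁`, `g₂` and `g₁ g₂`.  The operator
`F(w₁, x) w₂ = ∑_{h ∈ ℂ} ∑_{k ∈ ℕ} F h k w₁ w₂ x^{-h-1} (log x)^k` is given by its coefficients
`F h k`, which are bilinear maps `W₁ × W₂ → W₃`. -/
structure IsIntertwiningOperator (M₁ : WeakTwistedModule A g₁ W₁) (M₂ : WeakTwistedModule A g₂ W₂)
    (M₃ : WeakTwistedModule A (g₁ * g₂) W₃) (F : ℂ → ℕ → W₁ →ₗ[ℂ] W₂ →ₗ[ℂ] W₃) : Prop where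
  /-- `F(w₁, x) w₂` lies in `W₃[log x]{x}`. -/
  log_finite : ∀ (w₁ : W₁) (w₂ : W₂) (h : ℂ), ∃ K : ℕ, ∀ k ≥ K, F h k w₁ w₂ = 0
  /-- Lower truncation, uniformly in the power of `log x`. -/
  truncation : ∀ (w₁ : W₁) (w₂ : W₂) (h : ℂ), ∃ N : ℕ, ∀ n ≥ N, ∀ k : ℕ, F (h + n) k w₁ w₂ = 0
  /-- The twisted Jacobi identity for `v ∈ V^{(r₁, r₂)}`: the coefficient of
  `x₀^{-a-1} x₁^{-b-1} x₂^{-h-1} (log x₂)^k`, where `a = n - r₁/T₁` and `b = m - r₂/T₂`, and where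
  `(-x₂)^s` means `e^{πis} x₂^s`.  The exponents of `x₀` and `x₁` in all three terms lie in
  `r₁/T₁ + ℤ` and `r₂/T₂ + ℤ`, so that these are all the coefficients. -/
  jacobi : ∀ r₁ < orderOf g₁, ∀ r₂ < orderOf g₂,
    ∀ v ∈ VertexOperatorAlgebra.sector g₁ r₁ ⊓ VertexOperatorAlgebra.sector g₂ r₂,
    ∀ (w₁ : W₁) (w₂ : W₂) (n m : ℤ) (a b : ℚ), a = n - (r₁ : ℚ) / orderOf g₁ →
    b = m - (r₂ : ℚ) / orderOf g₂ → ∀ (h : ℂ) (k : ℕ),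
    (∑ᶠ i : ℕ, ((-1 : ℂ) ^ i * Ring.choose (a : ℂ) i) •
        M₃.Y v (a + b - i) (F (h + i) k w₁ w₂))
      - (∑ᶠ i : ℕ, (Ring.choose (a : ℂ) i * Complex.exp (Real.pi * Complex.I * (a - i))) •
          F (h + a - i) k w₁ (M₂.Y v (b + i) w₂))
      = ∑ᶠ i : ℕ, Ring.choose (b : ℂ) i • F (h + b - i) k (M₁.Y v (a + i) w₁) w₂
  /-- The `L(-1)`-derivative property: the coefficient of `x^{-h-1} (log x)^k` in
  `F(L(-1)w₁, x) = d/dx F(w₁, x)`. -/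
  derivative : ∀ (w₁ : W₁) (w₂ : W₂) (h : ℂ) (k : ℕ),
    F h k (M₁.L (-1) w₁) w₂
      = (-h) • F (h - 1) k w₁ w₂ + ((k : ℂ) + 1) • F (h - 1) (k + 1) w₁ w₂

theorem finite_support_of_eventually_zero {E : Type*} [Zero E] (f : ℕ → E) (N : ℕ)
    (hf : ∀ i ≥ N, f i = 0) : (Function.support f).Finite :=
  (Set.finite_lt_nat N).subset fun i hi => by
    by_contra hlt
    exact hi (hf i (not_lt.1 hlt))

theorem WeakTwistedModule.exists_mode_add_eq_zero {g : A.Aut} {W : Type*} [AddCommGroup W]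
    [Module ℂ W] (M : WeakTwistedModule A g W) {r : ℕ} (hr : r < orderOf g) {v : V}
    (hv : v ∈ VertexOperatorAlgebra.sector g r) (w : W) (b : ℚ) :
    ∃ N : ℕ, ∀ i ≥ N, M.Y v (b + (i : ℕ)) w = 0 := by
  obtain ⟨N, hN⟩ := (M.twisted r hr v hv w).2
  obtain ⟨K, hK⟩ := exists_nat_ge (N - b)
  refine ⟨K, fun i hi => hN _ ?_⟩
  have : (K : ℚ) ≤ i := by exact_mod_cast hi
  linarith

/-- The vector space of twisted logarithmic intertwining operators of type `(W₃ ; W₁ W₂)`. -/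
def intertwiningOperators (M₁ : WeakTwistedModule A g₁ W₁) (M₂ : WeakTwistedModule A g₂ W₂)
    (M₃ : WeakTwistedModule A (g₁ * g₂) W₃) : Submodule ℂ (ℂ → ℕ → W₁ →ₗ[ℂ] W₂ →ₗ[ℂ] W₃) where
  carrier := {F | IsIntertwiningOperator M₁ M₂ M₃ F}
  zero_mem' := ⟨by simp, by simp, by simp, by simp⟩
  add_mem' := by
    intro F G hF hG
    refine ⟨fun w₁ w₂ h => ?_, fun w₁ w₂ h => ?_, ?_, fun w₁ w₂ h k => ?_⟩
    · obtain ⟨N, hN⟩ := hF.log_finite w₁ w₂ h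
      obtain ⟨N', hN'⟩ := hG.log_finite w₁ w₂ h
      refine ⟨max N N', fun k hk => ?_⟩
      simp [hN k (le_trans (le_max_left _ _) hk), hN' k (le_trans (le_max_right _ _) hk)]
    · obtain ⟨N, hN⟩ := hF.truncation w₁ w₂ h
      obtain ⟨N', hN'⟩ := hG.truncation w₁ w₂ h
      refine ⟨max N N', fun n hn k => ?_⟩
      simp [hN n (le_trans (le_max_left _ _) hn) k, hN' n (le_trans (le_max_right _ _) hn) k]
    · intro r₁ hr₁ r₂ hr₂ v hv w₁ w₂ n m a b ha hb h k
      have e₁ := hF.jacobi r₁ hr₁ r₂ hr₂ v hv w₁ w₂ n m a b ha hb h k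
      have e₂ := hG.jacobi r₁ hr₁ r₂ hr₂ v hv w₁ w₂ n m a b ha hb h k
      obtain ⟨N₁, hN₁⟩ := M₁.exists_mode_add_eq_zero hr₁ hv.1 w₁ a
      obtain ⟨N₂, hN₂⟩ := M₂.exists_mode_add_eq_zero hr₂ hv.2 w₂ b
      obtain ⟨N₃, hN₃⟩ := hF.truncation w₁ w₂ h
      obtain ⟨N₄, hN₄⟩ := hG.truncation w₁ w₂ h
      simp only [LinearMap.add_apply, Pi.add_apply, map_add, smul_add]
      rw [finsum_add_distrib, finsum_add_distrib, finsum_add_distrib, ← e₁, ← e₂]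
      · abel
      · exact finite_support_of_eventually_zero _ N₁ fun i hi => by simp [hN₁ i hi]
      · exact finite_support_of_eventually_zero _ N₁ fun i hi => by simp [hN₁ i hi]
      · exact finite_support_of_eventually_zero _ N₂ fun i hi => by simp [hN₂ i hi]
      · exact finite_support_of_eventually_zero _ N₂ fun i hi => by simp [hN₂ i hi]
      · exact finite_support_of_eventually_zero _ N₃ fun i hi => by simp [hN₃ i hi]
      · exact finite_support_of_eventually_zero _ N₄ fun i hi => by simp [hN₄ i hi]
    · have e₁ := hF.derivative w₁ w₂ h k
      have e₂ := hG.derivative w₁ w₂ h k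
      simp only [LinearMap.add_apply, Pi.add_apply, smul_add, e₁, e₂]
      abel
  smul_mem' := by
    intro c F hF
    refine ⟨fun w₁ w₂ h => ?_, fun w₁ w₂ h => ?_, ?_, fun w₁ w₂ h k => ?_⟩
    · obtain ⟨N, hN⟩ := hF.log_finite w₁ w₂ h
      exact ⟨N, fun k hk => by simp [hN k hk]⟩
    · obtain ⟨N, hN⟩ := hF.truncation w₁ w₂ h
      exact ⟨N, fun n hn k => by simp [hN n hn k]⟩
    · intro r₁ hr₁ r₂ hr₂ v hv w₁ w₂ n m a b ha hb h k
      have e₁ := hF.jacobi r₁ hr₁ r₂ hr₂ v hv w₁ w₂ n m a b ha hb h k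
      simp only [LinearMap.smul_apply, Pi.smul_apply, map_smul,
        smul_comm _ c]
      rw [← smul_finsum, ← smul_finsum, ← smul_finsum, ← e₁, smul_sub]
    · have e₁ := hF.derivative w₁ w₂ h k
      simp only [LinearMap.smul_apply, Pi.smul_apply, e₁, smul_add,
        smul_comm _ c]

end Intertwining

end

/-! ### Mode sums and generalized eigenspaces -/

noncomputable section

/-! The heart is one step `S ⋖ S'` of a composition series of `W₃`. Choose a weight `μ`, lowest in
its coset of `(1/T₃)ℤ`, at which `S'` is not contained in `S`, and a functional `φ` that kills `S`
and every weight space except `μ` but not `S'`. Modes that raise weight send `S'` into `ker φ`,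
because whatever they carry to weight `μ` starts below `μ`, hence in `S`
(`exists_lowest_functional`).

Let `F` be an intertwining operator with values in `S'`. Modulo `ker φ`, the Jacobi identity
replaces a coefficient with one argument a generator of `C₁` by coefficients of smaller total weight
(`mem_of_left_generator`, `mem_of_right_generator`). As weights are bounded below in each coset, the
log-free part of `φ ∘ F` is determined by homogeneous generators of `W₁` and `W₂` modulo `C₁`
(`mem_of_generators`). For each pair of generators, only one exponent gives weight `μ`, so one
number per pair suffices. Higher powers of `log x` follow from the `L(-1)`-derivative property.

If all these numbers vanish, `ker φ` contains the coefficients of `F`. Their span is a submodule,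
and together with `S` it lies between `S` and `S'` without being `S'`; hence it is `S`. Each step
thus adds at most `dim(W₁/C₁) · dim(W₂/C₁)` dimensions, and a simple `W₃` is a single step. -/

theorem finsum_mem_submodule {E : Type*} [AddCommGroup E] [Module ℂ E] {N : Submodule ℂ E}
    {f : ℕ → E} (h : ∀ i, f i ∈ N) : ∑ᶠ i, f i ∈ N :=
  finsum_induction (· ∈ N) N.zero_mem (fun _ _ => N.add_mem) h

/-- Isolates the leading term of a Jacobi sum. The vanishing from `K` on is essential, since a
`finsum` of infinite support is zero by default. -/
theorem mem_of_finsum_mem {E : Type*} [AddCommGroup E] [Module ℂ E] {N : Submodule ℂ E}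
    {f : ℕ → E} {x : E} (hfx : ∑ᶠ i, f i = x) (hx : x ∈ N) (K : ℕ) (hK : ∀ i ≥ K, f i = 0)
    (h : ∀ i, 0 < i → f i ∈ N) : f 0 ∈ N := by
  have hsupp : Function.support f ⊆ (Finset.range (K + 1) : Set ℕ) := by
    intro i hi
    by_contra hlt
    simp only [Finset.coe_range, Set.mem_Iio, not_lt] at hlt
    exact hi (hK i (by omega))
  rw [← hfx, finsum_eq_finsetSum_of_support_subset f hsupp, Finset.sum_range_succ'] at hx
  have hsum : ∑ i ∈ Finset.range K, f (i + 1) ∈ N := N.sum_mem fun i _ => h _ (Nat.succ_pos i)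
  simpa using N.sub_mem hx hsum

theorem finsum_eq_first {E : Type*} [AddCommGroup E] {f : ℕ → E} (h : ∀ i, 0 < i → f i = 0) :
    ∑ᶠ i, f i = f 0 :=
  finsum_eq_single f 0 fun i hi => h i (Nat.pos_of_ne_zero hi)

theorem finsum_eq_first_two {E : Type*} [AddCommGroup E] {f : ℕ → E} (h : ∀ i, 1 < i → f i = 0) :
    ∑ᶠ i, f i = f 0 + f 1 := by
  have hsupp : Function.support f ⊆ (Finset.range 2 : Set ℕ) := by
    intro i hi
    by_contra hlt
    simp only [Finset.coe_range, Set.mem_Iio, not_lt] at hlt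
    exact hi (h i (by omega))
  rw [finsum_eq_finsetSum_of_support_subset f hsupp]
  simp [Finset.sum_range_succ]

theorem Ring.choose_one_eq_zero {i : ℕ} (hi : 1 < i) : Ring.choose (1 : ℂ) i = 0 := by
  have := Ring.choose_natCast (R := ℂ) 1 i
  rw [Nat.cast_one] at this
  rw [this, Nat.choose_eq_zero_of_lt hi, Nat.cast_zero]

/-- If a sum of generalized eigenvectors for distinct eigenvalues lies in a stable subspace, then so
does every summand. -/
theorem Module.End.mem_of_sum_genEigenvector_mem {W : Type*} [AddCommGroup W] [Module ℂ W]
    (f : Module.End ℂ W) {S : Submodule ℂ W} (hS : ∀ x ∈ S, f x ∈ S) (s : Finset ℂ) :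
    ∀ y : ℂ → W, (∀ μ, y μ ∈ f.maxGenEigenspace μ) → ∑ μ ∈ s, y μ ∈ S → ∀ μ ∈ s, y μ ∈ S := by
  classical
  have haeval : ∀ p : Polynomial ℂ, ∀ x ∈ S, Polynomial.aeval f p x ∈ S := by
    intro p x hx
    induction p using Polynomial.induction_on' with
    | add p q hp hq =>
      rw [map_add, LinearMap.add_apply]
      exact S.add_mem hp hq
    | monomial n c =>
      have : (f ^ n) x ∈ S := by
        induction n with
        | zero => simpa using hx
        | succ n ih =>
          rw [pow_succ', Module.End.mul_apply]
          exact hS _ ih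
      rw [Polynomial.aeval_monomial, Module.End.mul_apply, Module.algebraMap_end_apply]
      exact S.smul_mem _ this
  have hpow : ∀ (ν : ℂ) (k : ℕ), Polynomial.aeval f ((Polynomial.X - Polynomial.C ν) ^ k) =
      (f - ν • (1 : Module.End ℂ W)) ^ k := by
    intro ν k
    rw [map_pow, map_sub, Polynomial.aeval_X, Polynomial.aeval_C, Algebra.algebraMap_eq_smul_one]
  induction s using Finset.induction_on with
  | empty => simp
  | insert ν s hν ih =>
    intro y hy hsum
    obtain ⟨k, hk⟩ := (Module.End.mem_maxGenEigenspace _ _ _).1 (hy ν)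
    rw [← hpow] at hk
    set P := (Polynomial.X - Polynomial.C ν) ^ k with hP
    -- Applying `P` removes the `ν`-component, so induction puts `P(f) (y μ)` in `S`. As `P` is
    -- coprime to a power of `X - μ` that kills `y μ`, a Bézout coefficient recovers `y μ`.
    have hmem : ∀ μ ∈ s, y μ ∈ S := by
      have h1 : ∑ μ ∈ s, Polynomial.aeval f P (y μ) ∈ S := by
        have := haeval P _ hsum
        rwa [Finset.sum_insert hν, map_add, hk, zero_add, map_sum] at this
      have h2 := ih (fun μ => Polynomial.aeval f P (y μ)) (fun μ =>
        Module.End.mapsTo_maxGenEigenspace_of_comm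
          (show Commute f (Polynomial.aeval f P) by
            simpa only [Polynomial.aeval_X] using
              (Polynomial.commute_X (R := ℂ) P).map (Polynomial.aeval f)) μ (hy μ)) h1
      intro μ hμ
      have hne : μ ≠ ν := fun h => hν (h ▸ hμ)
      obtain ⟨l, hl⟩ := (Module.End.mem_maxGenEigenspace _ _ _).1 (hy μ)
      rw [← hpow] at hl
      obtain ⟨a, b, hab⟩ : IsCoprime P ((Polynomial.X - Polynomial.C μ) ^ l) :=
        (Polynomial.isCoprime_X_sub_C_of_isUnit_sub (sub_ne_zero.2 hne.symm).isUnit).pow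
      have := congrArg (fun p => Polynomial.aeval f p (y μ)) hab
      simp only [map_add, map_mul, LinearMap.add_apply, Module.End.mul_apply, hl, map_zero,
        add_zero, map_one, Module.End.one_apply] at this
      rw [← this]
      exact haeval a _ (h2 μ hμ)
    intro μ hμ
    rcases Finset.mem_insert.1 hμ with rfl | hμ
    · rw [Finset.sum_insert hν] at hsum
      simpa using S.sub_mem hsum (S.sum_mem hmem)
    · exact hmem μ hμ

/-- Projections onto the generalized eigenspaces of an operator whose generalized eigenspaces
span. -/
theorem Module.End.exists_genEigenspace_proj {W : Type*} [AddCommGroup W] [Module ℂ W]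
    (f : Module.End ℂ W) (hf : ⨆ μ, f.maxGenEigenspace μ = ⊤) :
    ∃ π : ℂ → Module.End ℂ W, (∀ μ w, π μ w ∈ f.maxGenEigenspace μ) ∧
      (∀ μ, ∀ w ∈ f.maxGenEigenspace μ, π μ w = w) ∧
      (∀ μ ν, ν ≠ μ → ∀ w ∈ f.maxGenEigenspace ν, π μ w = 0) ∧
      ∀ S : Submodule ℂ W, (∀ x ∈ S, f x ∈ S) → ∀ μ, ∀ x ∈ S, π μ x ∈ S := by
  classical
  have hint : DirectSum.IsInternal fun μ => f.maxGenEigenspace μ :=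
    (DirectSum.isInternal_submodule_iff_iSupIndep_and_iSup_eq_top _).2
      ⟨f.independent_maxGenEigenspace, hf⟩
  let := hint.chooseDecomposition
  let π : ℂ → Module.End ℂ W := fun μ => (f.maxGenEigenspace μ).subtype ∘ₗ
    DirectSum.component ℂ ℂ (fun μ => f.maxGenEigenspace μ) μ ∘ₗ
      (DirectSum.decomposeLinearEquiv fun μ => f.maxGenEigenspace μ).toLinearMap
  have hπ : ∀ μ w, π μ w = DirectSum.decompose (fun μ => f.maxGenEigenspace μ) w μ :=
    fun _ _ => rfl
  have h₁ : ∀ μ, ∀ w ∈ f.maxGenEigenspace μ, π μ w = w := fun μ w hw => by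
    rw [hπ, DirectSum.decompose_of_mem_same _ hw]
  have h₂ : ∀ μ ν, ν ≠ μ → ∀ w ∈ f.maxGenEigenspace ν, π μ w = 0 := fun μ ν hne w hw => by
    rw [hπ, DirectSum.decompose_of_mem_ne _ hw hne]
  refine ⟨π, fun μ w => Subtype.property _, h₁, h₂, fun S hS μ x hx => ?_⟩
  obtain ⟨y, hy, hyx⟩ := (Submodule.mem_iSup_iff_exists_finsupp _ x).1
    (hf.symm ▸ Submodule.mem_top : x ∈ ⨆ μ, f.maxGenEigenspace μ)
  rw [← hyx] at hx
  have hyS := f.mem_of_sum_genEigenvector_mem hS y.support y hy hx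
  rw [← hyx, Finsupp.sum, map_sum]
  refine S.sum_mem fun ν hν => ?_
  by_cases h : ν = μ
  · subst h
    rw [h₁ _ _ (hy ν)]
    exact hyS ν hν
  · rw [h₂ _ _ h _ (hy ν)]
    exact S.zero_mem

/-! ### Eigenspaces of automorphisms of `V` -/

namespace VertexOperatorAlgebra

variable {V : Type*} [AddCommGroup V] [Module ℂ V] {A : VertexOperatorAlgebra V}

theorem mem_sector {g : A.Aut} {r : ℕ} {v : V} : v ∈ sector g r ↔
    (g : V ≃ₗ[ℂ] V) v = Complex.exp (-(2 * Real.pi * Complex.I * r / orderOf g)) • v := by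
  rw [sector, Module.End.mem_eigenspace_iff]
  rfl

theorem mem_wt {n : ℤ} {v : V} : v ∈ A.wt n ↔ A.Y A.ω 1 v = (n : ℂ) • v := by
  rw [wt, Module.End.mem_eigenspace_iff]

theorem map_conformal (g : A.Aut) : (g : V ≃ₗ[ℂ] V) A.ω = A.ω := g.2.2.1

theorem map_mode (g : A.Aut) (u v : V) (n : ℤ) :
    (g : V ≃ₗ[ℂ] V) (A.Y u n v) = A.Y ((g : V ≃ₗ[ℂ] V) u) n ((g : V ≃ₗ[ℂ] V) v) := g.2.2.2 u v n

theorem conformal_mem_sector (g : A.Aut) : A.ω ∈ sector g 0 := by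
  rw [mem_sector, map_conformal]
  simp

theorem map_mem_wt (g : A.Aut) {n : ℤ} {v : V} (hv : v ∈ A.wt n) :
    (g : V ≃ₗ[ℂ] V) v ∈ A.wt n := by
  rw [mem_wt] at hv ⊢
  have := map_mode g A.ω v 1
  rw [map_conformal, hv, map_smul] at this
  exact this.symm

theorem translate_mem_sector {g : A.Aut} {r : ℕ} {v : V} (hv : v ∈ sector g r) :
    A.Y A.ω 0 v ∈ sector g r := by
  rw [mem_sector] at hv ⊢
  rw [map_mode, map_conformal, hv, map_smul]

theorem map_mem_sector {g h : A.Aut} (hgh : Commute g h) {r : ℕ} {v : V} (hv : v ∈ sector g r) :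
    (h : V ≃ₗ[ℂ] V) v ∈ sector g r := by
  rw [mem_sector] at hv ⊢
  have : (g : V ≃ₗ[ℂ] V) ((h : V ≃ₗ[ℂ] V) v) = (h : V ≃ₗ[ℂ] V) ((g : V ≃ₗ[ℂ] V) v) :=
    congrArg (fun k : A.Aut => (k : V ≃ₗ[ℂ] V) v) hgh.eq
  rw [this, hv, map_smul]

/-- A subspace stable under an automorphism of finite order is the sum of its intersections with
the eigenspaces. -/
theorem le_iSup_inf_sector {g : A.Aut} (hg : IsOfFinOrder g) {N : Submodule ℂ V}
    (hN : ∀ v ∈ N, (g : V ≃ₗ[ℂ] V) v ∈ N) :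
    N ≤ ⨆ r : Fin (orderOf g), N ⊓ sector g r := by
  intro v hv
  set T := orderOf g with hT
  have hT0 : 0 < T := hg.orderOf_pos
  have hTC : (T : ℂ) ≠ 0 := Nat.cast_ne_zero.2 hT0.ne'
  set ζ : ℂ := Complex.exp (2 * Real.pi * Complex.I / T) with hζ
  have hprim : IsPrimitiveRoot ζ T := Complex.isPrimitiveRoot_exp T hT0.ne'
  let G : Module.End ℂ V := ((g : V ≃ₗ[ℂ] V) : V →ₗ[ℂ] V)
  have hGN : ∀ j : ℕ, (G ^ j) v ∈ N := by
    intro j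
    induction j with
    | zero => simpa using hv
    | succ j ih =>
      rw [pow_succ', Module.End.mul_apply]
      exact hN _ ih
  have hGpow : ∀ j : ℕ, ∀ x, (G ^ j) x = ((g ^ j : A.Aut) : V ≃ₗ[ℂ] V) x := by
    intro j
    induction j with
    | zero => intro x; rfl
    | succ j ih =>
      intro x
      rw [pow_succ, Module.End.mul_apply, ih, pow_succ]
      rfl
  have hGT : (G ^ T) v = v := by
    rw [hGpow, pow_orderOf_eq_one]
    rfl
  -- Discrete Fourier transform over the cyclic group generated by `g`: `p r` is `T` times the
  -- component of `v` in `sector g r`.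
  let p : ℕ → V := fun r => ∑ j ∈ Finset.range T, ζ ^ (r * j) • (G ^ j) v
  have hpN : ∀ r, p r ∈ N := fun r => N.sum_mem fun j _ => N.smul_mem _ (hGN j)
  have hGp : ∀ r, ζ ^ r • G (p r) = p r := by
    intro r
    have h1 : ζ ^ r • G (p r) = ∑ j ∈ Finset.range T, ζ ^ (r * (j + 1)) • (G ^ (j + 1)) v := by
      simp only [p, map_sum, Finset.smul_sum, map_smul, smul_smul]
      refine Finset.sum_congr rfl fun j _ => ?_
      rw [pow_succ' G, Module.End.mul_apply, ← pow_add]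
      congr 2
      ring
    have h2 := Finset.sum_range_succ' (fun j => ζ ^ (r * j) • (G ^ j) v) T
    rw [Finset.sum_range_succ, hGT, mul_comm r T, pow_mul, hprim.pow_eq_one] at h2
    rw [h1]
    simpa using h2.symm
  have hps : ∀ r, p r ∈ sector g r := by
    intro r
    rw [mem_sector]
    have hexp : Complex.exp (-(2 * Real.pi * Complex.I * r / orderOf g)) * ζ ^ r = 1 := by
      rw [hζ, ← Complex.exp_nat_mul, ← Complex.exp_add, ← Complex.exp_zero]
      congr 1
      rw [← hT]
      ring
    calc (g : V ≃ₗ[ℂ] V) (p r) = G (p r) := rfl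
      _ = (Complex.exp (-(2 * Real.pi * Complex.I * r / orderOf g)) * ζ ^ r) • G (p r) := by
        rw [hexp, one_smul]
      _ = _ := by rw [mul_smul, hGp]
  have hsum : ∑ r ∈ Finset.range T, p r = (T : ℂ) • v := by
    simp only [p]
    rw [Finset.sum_comm]
    simp only [← Finset.sum_smul]
    rw [Finset.sum_eq_single_of_mem 0 (Finset.mem_range.2 hT0)]
    · simp
    · intro j hj hj0
      have hne : ζ ^ j ≠ 1 := fun h =>
        absurd (Nat.le_of_dvd (Nat.pos_of_ne_zero hj0) ((hprim.pow_eq_one_iff_dvd j).1 h))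
          (not_le.2 (Finset.mem_range.1 hj))
      have hgeom : ∑ r ∈ Finset.range T, (ζ ^ j) ^ r = 0 := by
        refine eq_zero_of_ne_zero_of_mul_left_eq_zero (sub_ne_zero_of_ne hne.symm) ?_
        rw [mul_neg_geom_sum, ← pow_mul, mul_comm j T, pow_mul, hprim.pow_eq_one, one_pow, sub_self]
      rw [show ∑ r ∈ Finset.range T, ζ ^ (r * j) = ∑ r ∈ Finset.range T, (ζ ^ j) ^ r from
        Finset.sum_congr rfl fun r _ => by rw [← pow_mul, mul_comm], hgeom, zero_smul]
  have hv' : v = (T : ℂ)⁻¹ • ∑ r ∈ Finset.range T, p r := by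
    rw [hsum, smul_smul, inv_mul_cancel₀ hTC, one_smul]
  rw [hv']
  refine Submodule.smul_mem _ _ (Submodule.sum_mem _ fun r hr => ?_)
  exact Submodule.mem_iSup_of_mem (p := fun r : Fin T => N ⊓ sector g r)
    ⟨r, Finset.mem_range.1 hr⟩ ⟨hpN r, hps r⟩

/-- To prove a linear condition on a subspace stable under an automorphism of finite order, it
suffices to treat eigenvectors. -/
theorem sector_induction {g : A.Aut} (hg : IsOfFinOrder g) {N P : Submodule ℂ V}
    (hN : ∀ v ∈ N, (g : V ≃ₗ[ℂ] V) v ∈ N)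
    (h : ∀ r < orderOf g, ∀ v ∈ N, v ∈ sector g r → v ∈ P) : N ≤ P :=
  (le_iSup_inf_sector hg hN).trans (iSup_le fun r v hv => h r r.2 v hv.1 hv.2)

/-- A nonzero simultaneous eigenvector of `g₁` and `g₂` is an eigenvector of `g₁ g₂`, with
compatible exponents. -/
theorem exists_mem_sector_mul {g₁ g₂ : A.Aut} (hg : IsOfFinOrder (g₁ * g₂)) {r₁ r₂ : ℕ}
    {v : V} (hv₁ : v ∈ sector g₁ r₁) (hv₂ : v ∈ sector g₂ r₂) (hv : v ≠ 0) :
    ∃ r < orderOf (g₁ * g₂), v ∈ sector (g₁ * g₂) r ∧ ∃ z : ℤ,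
      (r₁ : ℚ) / orderOf g₁ + (r₂ : ℚ) / orderOf g₂ = (r : ℚ) / orderOf (g₁ * g₂) + z := by
  rw [mem_sector] at hv₁ hv₂
  by_contra hcon
  push Not at hcon
  -- The line through `v` is stable under `g₁ g₂`, hence spanned by eigenvectors with exponents in
  -- the required range; a nonzero one would give the excluded `r`. The integer `z` is the ambiguity
  -- of the complex logarithm.
  have hlin : Submodule.span ℂ {v} ≤ (⊥ : Submodule ℂ V) := by
    have hmul : ∀ x : V, ((g₁ * g₂ : A.Aut) : V ≃ₗ[ℂ] V) x = (g₁ : V ≃ₗ[ℂ] V) ((g₂ : V ≃ₗ[ℂ] V) x) :=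
      fun _ => rfl
    refine sector_induction hg (fun x hx => ?_) fun r hr x hx hxr => ?_
    · obtain ⟨c, rfl⟩ := Submodule.mem_span_singleton.1 hx
      rw [hmul, map_smul, map_smul, hv₂, map_smul, hv₁, smul_smul, smul_smul]
      exact Submodule.smul_mem _ _ (Submodule.mem_span_singleton_self v)
    · obtain ⟨c, rfl⟩ := Submodule.mem_span_singleton.1 hx
      by_cases hc : c = 0
      · simp [hc]
      exfalso
      have hvr : v ∈ sector (g₁ * g₂) r := by
        simpa [smul_smul, hc] using (sector (g₁ * g₂) r).smul_mem c⁻¹ hxr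
      have hvr' := hvr
      rw [mem_sector, hmul, hv₂, map_smul, hv₁, smul_smul, ← Complex.exp_add] at hvr'
      have hexp := smul_left_injective ℂ hv hvr'
      obtain ⟨z, hz⟩ := Complex.exp_eq_exp_iff_exists_int.1 hexp
      refine hcon r hr hvr (-z) ?_
      have hz' : (2 * Real.pi * Complex.I) * ((r₁ : ℂ) / orderOf g₁ + (r₂ : ℂ) / orderOf g₂) =
          (2 * Real.pi * Complex.I) * ((r : ℂ) / orderOf (g₁ * g₂) + ((-z : ℤ) : ℂ)) := by
        push_cast
        linear_combination -hz
      have := mul_left_cancel₀ Complex.two_pi_I_ne_zero hz'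
      have hcast : ((((r₁ : ℚ) / orderOf g₁ + (r₂ : ℚ) / orderOf g₂ : ℚ)) : ℂ) =
          (((r : ℚ) / orderOf (g₁ * g₂) + (-z : ℤ) : ℚ) : ℂ) := by
        push_cast at this ⊢
        exact this
      exact Rat.cast_injective hcast
  exact hv ((Submodule.mem_bot ℂ).1 (hlin (Submodule.mem_span_singleton_self v)))

/-- The creation property for `L(-1)v`, rewritten by the derivative property. -/
theorem mode_neg_two_vac (v : V) : A.Y v (-2) A.vac = A.Y A.ω 0 v := by
  have h := A.derivative v (-1)
  have h' := (A.creation (A.Y A.ω 0 v)).1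
  rw [h] at h'
  simpa using h'

end VertexOperatorAlgebra

/-! ### Modes and weights on twisted modules -/

namespace WeakTwistedModule

open VertexOperatorAlgebra

variable {V : Type*} [AddCommGroup V] [Module ℂ V] {A : VertexOperatorAlgebra V} {g : A.Aut}
  {W : Type*} [AddCommGroup W] [Module ℂ W] (M : WeakTwistedModule A g W)

theorem L_zero : M.L 0 = M.Y A.ω 1 := by simp [L]

theorem L_neg_one : M.L (-1) = M.Y A.ω 0 := by simp [L]

/-- The derivative property is not an axiom of twisted modules. It follows from the Jacobi identity
with second vector the vacuum and `n = -2`: the left side vanishes and the right side keeps only its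
first two terms. -/
theorem mode_translate_of_mem_sector {r : ℕ} (hr : r < orderOf g) {u : V} (hu : u ∈ sector g r)
    (q : ℚ) (w : W) : M.Y (A.Y A.ω 0 u) q w = -(q : ℂ) • M.Y u (q - 1) w := by
  by_cases hq : ∃ n : ℤ, q = n - (r : ℚ) / orderOf g
  · obtain ⟨m, hm⟩ := hq
    have h := M.jacobi r hr u hu A.vac w (-2) m 0 q hm
    rw [finsum_eq_zero_of_forall_eq_zero, finsum_eq_zero_of_forall_eq_zero, finsum_eq_first_two]
      at h
    · simp only [Ring.choose_zero_right, Ring.choose_one_right, Nat.cast_zero, add_zero, sub_zero,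
        zero_add, one_smul, mode_neg_two_vac, Nat.cast_one] at h
      norm_num [(A.creation u).1] at h
      rw [neg_smul]
      exact eq_neg_of_add_eq_zero_left h.symm
    · intro i hi
      rw [(A.creation u).2 _ (by omega)]
      simp
    · intro i
      rw [M.vacuum, if_neg]
      · simp
      · intro h
        have hi : (0 : ℚ) ≤ i := Nat.cast_nonneg i
        push_cast at h
        linarith
    · intro i
      rw [M.vacuum, if_neg]
      · simp
      · intro h
        have hi : (0 : ℚ) ≤ i := Nat.cast_nonneg i
        linarith
  · rw [(M.twisted r hr _ (translate_mem_sector hu) w).1 q hq, (M.twisted r hr u hu w).1, smul_zero]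
    rintro ⟨n, hn⟩
    exact hq ⟨n + 1, by push_cast; linarith⟩

theorem mode_eq_zero (hg : IsOfFinOrder g) (v : V) :
    ∀ q : ℚ, (¬ ∃ n : ℤ, q = n / orderOf g) → M.Y v q = 0 := by
  intro q hq
  suffices (⊤ : Submodule ℂ V) ≤ LinearMap.ker ((LinearMap.proj q).comp M.Y) from
    this (Submodule.mem_top (x := v))
  refine sector_induction hg (fun _ _ => Submodule.mem_top) fun r hr v _ hv => ?_
  refine LinearMap.mem_ker.2 (LinearMap.ext fun w => ?_)
  refine (M.twisted r hr v hv w).1 q ?_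
  rintro ⟨n, hn⟩
  refine hq ⟨n * orderOf g - r, ?_⟩
  have : (orderOf g : ℚ) ≠ 0 := Nat.cast_ne_zero.2 hg.orderOf_pos.ne'
  rw [hn]
  push_cast
  field_simp

theorem mode_translate (hg : IsOfFinOrder g) (u : V) (q : ℚ) (w : W) :
    M.Y (A.Y A.ω 0 u) q w = -(q : ℂ) • M.Y u (q - 1) w := by
  have : (⊤ : Submodule ℂ V) ≤ LinearMap.eqLocus
      ((LinearMap.applyₗ w).comp ((LinearMap.proj q).comp (M.Y.comp (A.Y A.ω 0))))
      (-(q : ℂ) • (LinearMap.applyₗ w).comp ((LinearMap.proj (q - 1)).comp M.Y)) :=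
    sector_induction hg (fun _ _ => Submodule.mem_top) fun r hr v _ hv =>
      M.mode_translate_of_mem_sector hr hv q w
  exact this (Submodule.mem_top (x := u))

/-- The commutator of `L(0)` with the modes of a homogeneous vector. -/
theorem L_zero_mode (hg : IsOfFinOrder g) {n : ℤ} {u : V} (hu : u ∈ A.wt n) (q : ℚ) (w : W) :
    M.L 0 (M.Y u q w) = M.Y u q (M.L 0 w) + ((n : ℂ) - q - 1) • M.Y u q w := by
  -- This coefficient is the commutator formula `[ω_1, u_q] = (L(-1)u)_{q+1} + (L(0)u)_q`.
  have h := M.jacobi 0 hg.orderOf_pos A.ω (conformal_mem_sector g) u w 0 1 q 1 (by simp)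
  rw [finsum_eq_first, finsum_eq_first, finsum_eq_first_two] at h
  · simp only [Ring.choose_zero_right, Ring.choose_one_right, Nat.cast_zero, add_zero, sub_zero,
      zero_add, one_smul, Nat.cast_one, Int.cast_zero, pow_zero, one_mul, zpow_zero, Rat.cast_one,
      M.mode_translate hg, add_sub_cancel_right, mem_wt.1 hu, map_smul, Pi.smul_apply,
      LinearMap.smul_apply] at h
    rw [L_zero, ← sub_eq_iff_eq_add', h, ← add_smul]
    congr 1
    push_cast
    ring
  · intro i hi
    rw [Rat.cast_one, Ring.choose_one_eq_zero hi, zero_smul]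
  · intro i hi
    rw [Int.cast_zero, Ring.choose_zero_pos ℂ hi, mul_zero, zero_smul]
  · intro i hi
    rw [Int.cast_zero, Ring.choose_zero_pos ℂ hi, mul_zero, zero_smul]

/-- The commutator formula makes `u_q` intertwine `L(0) - μ` with `L(0) - ν`, and hence their
powers. -/
theorem mode_mem_weightSpace (hg : IsOfFinOrder g) {n : ℤ} {u : V} (hu : u ∈ A.wt n) (q : ℚ)
    {μ ν : ℂ} (hν : ν = μ + ((n : ℂ) - q - 1)) {w : W} (hw : w ∈ M.weightSpace μ) :
    M.Y u q w ∈ M.weightSpace ν := by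
  obtain ⟨k, hk⟩ := (Module.End.mem_maxGenEigenspace _ _ _).1 hw
  refine (Module.End.mem_maxGenEigenspace _ _ _).2 ⟨k, ?_⟩
  have hcomm : ∀ (k : ℕ) (w : W), ((M.L 0 - ν • (1 : Module.End ℂ W)) ^ k) (M.Y u q w) =
      M.Y u q (((M.L 0 - μ • (1 : Module.End ℂ W)) ^ k) w) := by
    intro k
    induction k with
    | zero => intro w; simp
    | succ k ih =>
      intro w
      rw [pow_succ, Module.End.mul_apply, pow_succ, Module.End.mul_apply, ← ih]
      congr 1
      simp only [LinearMap.sub_apply, LinearMap.smul_apply, Module.End.one_apply, map_sub, map_smul,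
        M.L_zero_mode hg hu, hν]
      module
  rw [hcomm, hk, map_zero]

theorem mem_weightSpace_of_sub_mem {μ : ℂ} {w : W} (h : M.L 0 w - μ • w ∈ M.weightSpace μ) :
    w ∈ M.weightSpace μ := by
  obtain ⟨k, hk⟩ := (Module.End.mem_maxGenEigenspace _ _ _).1 h
  refine (Module.End.mem_maxGenEigenspace _ _ _).2 ⟨k + 1, ?_⟩
  rw [pow_succ, Module.End.mul_apply]
  exact hk

variable {M}

theorem IsGeneralized.iSup_weightSpace (hM : M.IsGeneralized) : ⨆ μ, M.weightSpace μ = ⊤ :=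
  hM.1.submodule_iSup_eq_top

/-- A linear condition holds on a generalized module once it holds for homogeneous vectors. -/
theorem IsGeneralized.induction (hM : M.IsGeneralized) {P : Submodule ℂ W}
    (h : ∀ μ, ∀ w ∈ M.weightSpace μ, w ∈ P) (w : W) : w ∈ P :=
  (hM.iSup_weightSpace ▸ iSup_le h : (⊤ : Submodule ℂ W) ≤ P) Submodule.mem_top

theorem IsSubmodule.L_zero_mem {S : Submodule ℂ W} (hS : M.IsSubmodule S) :
    ∀ x ∈ S, M.L 0 x ∈ S := fun x hx => hS _ _ x hx

/-! ### Homogeneous generators modulo `C₁` and lowest functionals -/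

variable (M) in
/-- The homogeneous elements of weight `μ` among the spanning elements of `C₁(W)`. -/
def c₁Generators (μ : ℂ) : Set W :=
  {x | ∃ r < orderOf g, ∃ v ∈ sector g r, ∃ n : ℤ, v ∈ A.wt n ∧
    (0 : ℚ) < n + (r : ℚ) / orderOf g ∧
    ∃ w ∈ M.weightSpace (μ - n - ((r : ℚ) / orderOf g : ℚ)),
      x = M.Y v (-1 - (r : ℚ) / orderOf g) w}

/-- There are `dim W/C₁(W)` homogeneous vectors such that every homogeneous vector is the sum of a
combination of those of the same weight and of a homogeneous element of `C₁(W)`. -/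
theorem IsGeneralized.exists_homogeneous_generators (hM : M.IsGeneralized) (hg : IsOfFinOrder g)
    (hC : M.IsC₁Cofinite) :
    ∃ (b : Fin (finrank ℂ (W ⧸ M.C₁)) → W) (wt : Fin (finrank ℂ (W ⧸ M.C₁)) → ℂ),
      (∀ i, b i ∈ M.weightSpace (wt i)) ∧
      ∀ μ, M.weightSpace μ ≤ Submodule.span ℂ (Set.range b ∩ M.weightSpace μ ∪ M.c₁Generators μ) := by
  have : FiniteDimensional ℂ (W ⧸ M.C₁) := hC
  obtain ⟨π, hπ₁, hπ₂, hπ₃, -⟩ := (M.L 0).exists_genEigenspace_proj hM.iSup_weightSpace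
  -- Homogeneous vectors span `W`, so a basis of the quotient can be chosen among their images.
  let s : Set (W ⧸ M.C₁) := M.C₁.mkQ '' {w | ∃ μ, w ∈ M.weightSpace μ}
  have hs : Submodule.span ℂ s = ⊤ := by
    have htop : Submodule.span ℂ {w | ∃ μ, w ∈ M.weightSpace μ} = ⊤ :=
      eq_top_iff.2 fun w _ => hM.induction (P := Submodule.span ℂ {w | ∃ μ, w ∈ M.weightSpace μ})
        (fun μ w hw => Submodule.subset_span ⟨μ, hw⟩) w
    rw [Submodule.span_image, htop, Submodule.map_top, Submodule.range_mkQ]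
  obtain ⟨f, hfs, hfspan, -⟩ := Submodule.exists_fun_fin_finrank_span_eq ℂ s
  have hrank : finrank ℂ (Submodule.span ℂ s) = finrank ℂ (W ⧸ M.C₁) := by
    rw [hs, finrank_top]
  choose b' hb' hbf using hfs
  choose wt' hwt' using hb'
  let b := b' ∘ Fin.cast hrank.symm
  have hspan : ∀ w : W, w ∈ Submodule.span ℂ (Set.range b) ⊔ M.C₁ := by
    intro w
    have : M.C₁.mkQ w ∈ Submodule.map M.C₁.mkQ (Submodule.span ℂ (Set.range b)) := by
      have hr : M.C₁.mkQ '' Set.range b = Set.range f := by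
        rw [← Set.range_comp]
        ext x
        constructor
        · rintro ⟨i, rfl⟩
          exact ⟨_, (hbf _).symm⟩
        · rintro ⟨i, rfl⟩
          exact ⟨Fin.cast hrank i, hbf _⟩
      rw [Submodule.map_span, hr, hfspan, hs]
      exact Submodule.mem_top
    obtain ⟨y, hy, hyw⟩ := this
    have hdiff : w - y ∈ M.C₁ := by
      rw [← Submodule.ker_mkQ M.C₁, LinearMap.mem_ker, map_sub, hyw, sub_self]
    exact Submodule.mem_sup.2 ⟨y, hy, w - y, hdiff, by abel⟩
  refine ⟨b, wt' ∘ Fin.cast hrank.symm, fun i => hwt' _, fun μ w hw => ?_⟩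
  set E := Submodule.span ℂ (Set.range b ∩ M.weightSpace μ ∪ M.c₁Generators μ) with hE
  -- The inequality covers both families spanning `C₁`: it means `n > 0` for `r = 0`, and `n ≥ 0`
  -- for `r ≥ 1` because `r < T`.
  have hgen : ∀ r < orderOf g, ∀ v ∈ sector g r, ∀ n : ℤ, v ∈ A.wt n →
      (0 : ℚ) < n + (r : ℚ) / orderOf g → ∀ w : W,
      M.Y v (-1 - (r : ℚ) / orderOf g) w ∈ E.comap (π μ) := by
    intro r hr v hv n hn hpos w
    refine hM.induction (P := (E.comap (π μ)).comap (M.Y v (-1 - (r : ℚ) / orderOf g)))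
      (fun ν w hw => ?_) w
    have hmem := M.mode_mem_weightSpace hg hn (-1 - (r : ℚ) / orderOf g) rfl hw
    rw [Submodule.mem_comap, Submodule.mem_comap]
    by_cases hν : ν + ((n : ℂ) - ((-1 - (r : ℚ) / orderOf g : ℚ) : ℂ) - 1) = μ
    · rw [hν] at hmem
      rw [hπ₂ _ _ hmem]
      refine Submodule.subset_span (Or.inr ⟨r, hr, v, hv, n, hn, hpos, w, ?_, rfl⟩)
      convert hw using 2
      rw [← hν]
      push_cast
      ring
    · rw [hπ₃ _ _ hν _ hmem]
      exact E.zero_mem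
  have htop : Submodule.span ℂ (Set.range b) ⊔ M.C₁ ≤ E.comap (π μ) := by
    refine sup_le (Submodule.span_le.2 ?_) (sup_le (Submodule.span_le.2 ?_) (Submodule.span_le.2 ?_))
    · rintro _ ⟨i, rfl⟩
      by_cases hi : wt' (Fin.cast hrank.symm i) = μ
      · have hb := hwt' (Fin.cast hrank.symm i)
        rw [hi] at hb
        change π μ (b i) ∈ E
        rw [show π μ (b i) = b i from hπ₂ _ _ hb]
        exact Submodule.subset_span (Or.inl ⟨⟨i, rfl⟩, hb⟩)
      · change π μ (b i) ∈ E
        rw [show π μ (b i) = 0 from hπ₃ _ _ hi _ (hwt' _)]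
        exact E.zero_mem
    · rintro _ ⟨v, hv, n, hn, hvn, w, rfl⟩
      have := hgen 0 hg.orderOf_pos v hv n hvn (by simpa using hn) w
      simpa using this
    · rintro _ ⟨r, hr1, hr, v, hv, n, hn, hvn, w, rfl⟩
      refine hgen r hr v hv n hvn ?_ w
      have h1 : (0 : ℚ) < r := Nat.cast_pos.2 hr1
      have h2 : (0 : ℚ) < orderOf g := Nat.cast_pos.2 hg.orderOf_pos
      have h3 : (0 : ℚ) ≤ n := Int.cast_nonneg hn
      positivity
  have := htop (hspan w)
  rwa [Submodule.mem_comap, hπ₂ _ _ hw] at this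

/-- For submodules `S < S'` there is a linear functional that vanishes on `S` and on all weight
spaces but one, does not vanish on `S'`, and vanishes on the images of `S'` under all modes that
raise weights. -/
theorem IsGeneralized.exists_lowest_functional (hM : M.IsGeneralized) (hg : IsOfFinOrder g)
    {S S' : Submodule ℂ W} (hS : M.IsSubmodule S) (hS' : M.IsSubmodule S') (hlt : ¬ S' ≤ S) :
    ∃ (φ : W →ₗ[ℂ] ℂ) (μ : ℂ), S ≤ LinearMap.ker φ ∧ ¬ S' ≤ LinearMap.ker φ ∧
      (∀ ν ≠ μ, M.weightSpace ν ≤ LinearMap.ker φ) ∧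
      ∀ (n : ℤ) (v : V) (q : ℚ), v ∈ A.wt n → 0 < n - q - 1 → ∀ x ∈ S',
        M.Y v q x ∈ LinearMap.ker φ := by
  obtain ⟨π, hπ₁, hπ₂, hπ₃, hπS⟩ := (M.L 0).exists_genEigenspace_proj hM.iSup_weightSpace
  have hsum : ∀ x : W, (∀ ν, π ν x ∈ S) → x ∈ S := by
    intro x hx
    obtain ⟨y, hy, hyx⟩ := (Submodule.mem_iSup_iff_exists_finsupp _ x).1
      (hM.iSup_weightSpace.symm ▸ Submodule.mem_top : x ∈ ⨆ μ, M.weightSpace μ)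
    rw [← hyx]
    refine S.sum_mem fun ν hν => ?_
    have : π ν x = y ν := by
      rw [← hyx, Finsupp.sum, map_sum, Finset.sum_eq_single_of_mem ν hν, hπ₂ _ _ (hy ν)]
      intro κ _ hκ
      exact hπ₃ _ _ hκ _ (hy κ)
    exact this ▸ hx ν
  obtain ⟨x₀, hx₀, hx₀S⟩ := Set.not_subset.1 hlt
  obtain ⟨μ₀, hμ₀⟩ : ∃ μ, π μ x₀ ∉ S := by
    by_contra! h
    exact hx₀S (hsum x₀ h)
  set T := orderOf g with hT
  -- The least `n` with `P n`, which exists because weights are bounded below in the coset, gives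
  -- the weight `μ`.
  let P : ℤ → Prop := fun n => ¬ S' ⊓ M.weightSpace (μ₀ + n / T) ≤ S
  obtain ⟨N, hN⟩ := hM.2 μ₀
  obtain ⟨n₀, hn₀, hmin⟩ : ∃ n, P n ∧ ∀ m, P m → n ≤ m := by
    refine Int.exists_least_of_bdd ⟨N, fun m hm => ?_⟩ ⟨0, fun h => hμ₀ (h ⟨?_, ?_⟩)⟩
    · by_contra hlt'
      refine hm ?_
      rw [hN m (by omega), inf_bot_eq]
      exact bot_le
    · exact hπS S' hS'.L_zero_mem _ _ hx₀
    · rw [Int.cast_zero, zero_div, add_zero]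
      exact hπ₁ μ₀ x₀
  set μ := μ₀ + n₀ / T with hμ
  obtain ⟨x, ⟨hxS', hxμ⟩, hxS⟩ := Set.not_subset.1 hn₀
  have hx : x ∉ S ⊔ LinearMap.ker (π μ) := by
    intro hx
    obtain ⟨y, hy, z, hz, hyz⟩ := Submodule.mem_sup.1 hx
    have h := hπ₂ _ _ hxμ
    rw [← hyz, map_add, LinearMap.mem_ker.1 hz, add_zero, hyz] at h
    exact hxS (h ▸ hπS S hS.L_zero_mem μ y hy)
  obtain ⟨φ, hφx, hφ⟩ := Submodule.exists_le_ker_of_notMem hx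
  have hφν : ∀ ν ≠ μ, M.weightSpace ν ≤ LinearMap.ker φ := fun ν hν w hw =>
    hφ (Submodule.mem_sup_right (LinearMap.mem_ker.2 (hπ₃ _ _ hν _ hw)))
  have hφS : S ≤ LinearMap.ker φ := le_sup_left.trans hφ
  refine ⟨φ, μ, hφS, fun h => hφx (h hxS'), hφν, fun n v q hv hpos y hy => ?_⟩
  by_cases hq : ∃ k : ℤ, q = k / orderOf g
  swap
  · rw [M.mode_eq_zero hg v q hq]
    exact Submodule.zero_mem _
  obtain ⟨k, hk⟩ := hq
  obtain ⟨z, hz, hzy⟩ := (Submodule.mem_iSup_iff_exists_finsupp _ y).1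
      (hM.iSup_weightSpace.symm ▸ Submodule.mem_top : y ∈ ⨆ μ, M.weightSpace μ)
  rw [← hzy] at hy
  have hzS' := (M.L 0).mem_of_sum_genEigenvector_mem hS'.L_zero_mem z.support z hz hy
  rw [← hzy, Finsupp.sum, map_sum]
  refine Submodule.sum_mem _ fun ν hν => ?_
  have hmem := M.mode_mem_weightSpace hg hv q rfl (hz ν)
  by_cases hνμ : ν + ((n : ℂ) - q - 1) = μ
  swap
  · exact hφν _ hνμ hmem
  -- The mode raises weight by `(nT - k - T)/T > 0`, so its argument has weight below `μ` in the
  -- same coset and lies in `S` by minimality.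
  refine hφS (hS _ _ _ ?_)
  have hT0 : 0 < T := hg.orderOf_pos
  have hTC : (T : ℂ) ≠ 0 := Nat.cast_ne_zero.2 hT0.ne'
  have hTQ : (0 : ℚ) < T := Nat.cast_pos.2 hT0
  have hlt' : 0 < n * T - k - T := by
    have h1 : (0 : ℚ) < (n - q - 1) * T := mul_pos hpos hTQ
    rw [hk, ← hT] at h1
    have h2 : ((n : ℚ) - k / T - 1) * T = ((n * T - k - T : ℤ) : ℚ) := by
      push_cast
      field_simp
    rw [h2] at h1
    exact_mod_cast h1
  have hνeq : ν = μ₀ + ((n₀ - (n * T - k - T) : ℤ) : ℂ) / T := by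
    rw [eq_sub_of_add_eq hνμ, hμ, hk, ← hT]
    push_cast
    field_simp
    ring
  have hP : ¬ P (n₀ - (n * T - k - T)) := fun h => by
    have := hmin _ h
    omega
  refine not_not.1 hP ⟨hzS' ν hν, ?_⟩
  rw [← hνeq]
  exact hz ν

end WeakTwistedModule

/-! ### Weights and span of the coefficients of an intertwining operator -/

section Intertwining

open VertexOperatorAlgebra

variable {V : Type*} [AddCommGroup V] [Module ℂ V] {A : VertexOperatorAlgebra V} {g₁ g₂ : A.Aut}
  {W₁ W₂ W₃ : Type*} [AddCommGroup W₁] [Module ℂ W₁] [AddCommGroup W₂] [Module ℂ W₂]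
  [AddCommGroup W₃] [Module ℂ W₃]
  {M₁ : WeakTwistedModule A g₁ W₁} {M₂ : WeakTwistedModule A g₂ W₂}
  {M₃ : WeakTwistedModule A (g₁ * g₂) W₃} {F : ℂ → ℕ → W₁ →ₗ[ℂ] W₂ →ₗ[ℂ] W₃}

namespace IsIntertwiningOperator

/-- The commutator of `L(0)` with an intertwining operator. -/
theorem L_zero_apply (hF : IsIntertwiningOperator M₁ M₂ M₃ F) (hg₁ : IsOfFinOrder g₁)
    (hg₂ : IsOfFinOrder g₂) (h : ℂ) (k : ℕ) (w₁ : W₁) (w₂ : W₂) :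
    M₃.L 0 (F h k w₁ w₂) = F h k (M₁.L 0 w₁) w₂ + F h k w₁ (M₂.L 0 w₂)
      - (h + 1) • F h k w₁ w₂ + ((k : ℂ) + 1) • F h (k + 1) w₁ w₂ := by
  have hJ := hF.jacobi 0 hg₁.orderOf_pos 0 hg₂.orderOf_pos A.ω
    ⟨conformal_mem_sector g₁, conformal_mem_sector g₂⟩ w₁ w₂ 0 1 0 1 (by simp) (by simp) h k
  rw [finsum_eq_first, finsum_eq_first, finsum_eq_first_two] at hJ
  · simp only [Ring.choose_zero_right, Ring.choose_one_right, Nat.cast_zero, add_zero, sub_zero,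
      zero_add, one_smul, Nat.cast_one, pow_zero, one_mul, Rat.cast_one, Rat.cast_zero, mul_zero,
      Complex.exp_zero, add_sub_cancel_right, ← M₁.L_zero, ← M₂.L_zero, ← M₃.L_zero,
      ← M₁.L_neg_one, hF.derivative] at hJ
    rw [sub_eq_iff_eq_add.1 hJ]
    module
  · intro i hi
    rw [Rat.cast_one, Ring.choose_one_eq_zero hi, zero_smul]
  · intro i hi
    rw [Rat.cast_zero, Ring.choose_zero_pos ℂ hi, zero_mul, zero_smul]
  · intro i hi
    rw [Rat.cast_zero, Ring.choose_zero_pos ℂ hi, mul_zero, zero_smul]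

/-- Subtracting the expected eigenvalue from `L(0)` leaves terms with `L(0) - μᵢ` applied to one
argument, plus a coefficient with a higher power of `log x`. Induction on both nilpotency orders,
and downward on `k`, closes the argument. -/
theorem apply_mem_weightSpace (hF : IsIntertwiningOperator M₁ M₂ M₃ F) (hg₁ : IsOfFinOrder g₁)
    (hg₂ : IsOfFinOrder g₂) {μ₁ μ₂ : ℂ} {w₁ : W₁} {w₂ : W₂} (hw₁ : w₁ ∈ M₁.weightSpace μ₁)
    (hw₂ : w₂ ∈ M₂.weightSpace μ₂) (h : ℂ) (k : ℕ) :
    F h k w₁ w₂ ∈ M₃.weightSpace (μ₁ + μ₂ - h - 1) := by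
  obtain ⟨p₁, hp₁⟩ := (Module.End.mem_maxGenEigenspace _ _ _).1 hw₁
  obtain ⟨p₂, hp₂⟩ := (Module.End.mem_maxGenEigenspace _ _ _).1 hw₂
  clear hw₁ hw₂
  induction p₁ generalizing w₁ w₂ p₂ k with
  | zero =>
    rw [pow_zero, Module.End.one_apply] at hp₁
    simp [hp₁]
  | succ p₁ ih₁ =>
    induction p₂ generalizing w₂ k with
    | zero =>
      rw [pow_zero, Module.End.one_apply] at hp₂
      simp [hp₂]
    | succ p₂ ih₂ =>
      rw [pow_succ, Module.End.mul_apply] at hp₁ hp₂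
      obtain ⟨K, hK⟩ := hF.log_finite w₁ w₂ h
      have key : ∀ d k, K ≤ k + d → F h k w₁ w₂ ∈ M₃.weightSpace (μ₁ + μ₂ - h - 1) := by
        intro d
        induction d with
        | zero =>
          intro k hk
          rw [hK k hk]
          exact Submodule.zero_mem _
        | succ d ihd =>
          intro k hk
          refine M₃.mem_weightSpace_of_sub_mem ?_
          have h₁ := ih₁ k hp₁ (p₂ + 1) (w₂ := w₂) (by rw [pow_succ, Module.End.mul_apply, hp₂])
          have h₂ := ih₂ k hp₂
          have h₃ := ihd (k + 1) (by omega)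
          have := Submodule.add_mem _ (Submodule.add_mem _ h₁ h₂)
            (Submodule.smul_mem _ ((k : ℂ) + 1) h₃)
          convert this using 1
          rw [hF.L_zero_apply hg₁ hg₂]
          simp only [LinearMap.sub_apply, LinearMap.smul_apply, Module.End.one_apply, map_sub,
            map_smul]
          module
      exact key K k (by omega)

/-- The span of the coefficients of an intertwining operator is a submodule. -/
theorem isSubmodule_span (hF : IsIntertwiningOperator M₁ M₂ M₃ F) (hg₁ : IsOfFinOrder g₁)
    (hg₂ : IsOfFinOrder g₂) (hg : Commute g₁ g₂) :
    M₃.IsSubmodule (Submodule.span ℂ {x | ∃ h k w₁ w₂, x = F h k w₁ w₂}) := by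
  set S := Submodule.span ℂ {x | ∃ h k w₁ w₂, x = F h k w₁ w₂}
  have hmem : ∀ h k w₁ w₂, F h k w₁ w₂ ∈ S := fun h k w₁ w₂ =>
    Submodule.subset_span ⟨h, k, w₁, w₂, rfl⟩
  suffices hmode : ∀ (v : V) (q : ℚ) h k w₁ w₂, M₃.Y v q (F h k w₁ w₂) ∈ S by
    intro v q w hw
    have hle : S ≤ S.comap (M₃.Y v q) := Submodule.span_le.2 (by
      rintro _ ⟨h, k, w₁, w₂, rfl⟩
      exact hmode v q h k w₁ w₂)
    exact hle hw
  intro v q h k w₁ w₂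
  suffices hle : (⊤ : Submodule ℂ V) ≤
      S.comap ((LinearMap.applyₗ (F h k w₁ w₂)).comp ((LinearMap.proj q).comp M₃.Y)) from
    hle (Submodule.mem_top (x := v))
  refine sector_induction hg₁ (fun _ _ => Submodule.mem_top) fun r₁ hr₁ v _ hv₁ => ?_
  refine sector_induction hg₂ (N := sector g₁ r₁) (fun _ => map_mem_sector hg)
    (fun r₂ hr₂ v hv₁ hv₂ => ?_) hv₁
  change M₃.Y v q (F h k w₁ w₂) ∈ S
  by_cases hv : v = 0
  · simp [hv]
  obtain ⟨r, hr, hvr, z, hz⟩ :=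
    exists_mem_sector_mul (hg.isOfFinOrder_mul hg₁ hg₂) hv₁ hv₂ hv
  by_cases hq : ∃ n : ℤ, q = n - (r : ℚ) / orderOf (g₁ * g₂)
  swap
  · rw [(M₃.twisted r hr v hvr _).1 q hq]
    exact S.zero_mem
  obtain ⟨n, hn⟩ := hq
  -- Take the Jacobi identity with `n = 0`. The terms after the first have coefficients `F (h + i)`,
  -- closer to truncation, so induction on the distance `d` handles them; the other two sums lie in
  -- `S`.
  have key : ∀ (d : ℕ) (m : ℤ) (h : ℂ), (∀ i ≥ d, F (h + i) k w₁ w₂ = 0) →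
      M₃.Y v (m - (r₁ : ℚ) / orderOf g₁ - (r₂ : ℚ) / orderOf g₂) (F h k w₁ w₂) ∈ S := by
    intro d
    induction d with
    | zero =>
      intro m h hd
      have h0 := hd 0 le_rfl
      rw [Nat.cast_zero, add_zero] at h0
      rw [h0, map_zero]
      exact S.zero_mem
    | succ d ih =>
      intro m h hd
      have hJ := hF.jacobi r₁ hr₁ r₂ hr₂ v ⟨hv₁, hv₂⟩ w₁ w₂ 0 m _ _ rfl rfl h k
      rw [sub_eq_iff_eq_add] at hJ
      have hfirst := mem_of_finsum_mem hJ
        (S.add_mem (finsum_mem_submodule fun i => S.smul_mem _ (hmem _ _ _ _))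
          (finsum_mem_submodule fun i => S.smul_mem _ (hmem _ _ _ _)))
        (d + 1) (fun i hi => by rw [hd i hi, map_zero, smul_zero]) (fun i hi => S.smul_mem _ ?_)
      · simp only [pow_zero, Ring.choose_zero_right, Nat.cast_zero, mul_one, one_smul, sub_zero,
          add_zero] at hfirst
        convert hfirst using 3
        push_cast
        ring
      · have := ih (m - i) (h + i) fun j hj => by
          have := hd (i + j) (by omega)
          push_cast at this
          rwa [← add_assoc] at this
        convert this using 3
        push_cast
        ring
  obtain ⟨N, hN⟩ := hF.truncation w₁ w₂ h
  have := key N (n + z) h fun i hi => hN i hi k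
  convert this using 3
  rw [hn]
  push_cast
  linarith

/-! ### Reduction to generators modulo `C₁` -/

/-- Reduction of a coefficient whose first argument is a generator of `C₁`, modulo a subspace `K`
that absorbs the modes in question. -/
theorem mem_of_left_generator (hF : IsIntertwiningOperator M₁ M₂ M₃ F) {K : Submodule ℂ W₃}
    (hK : ∀ (n : ℤ) (v : V) (q : ℚ), v ∈ A.wt n → 0 < n - q - 1 → ∀ h w₁ w₂,
      M₃.Y v q (F h 0 w₁ w₂) ∈ K)
    {r₁ r₂ : ℕ} (hr₁ : r₁ < orderOf g₁) (hr₂ : r₂ < orderOf g₂) {n : ℤ} {v : V}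
    (hv₁ : v ∈ sector g₁ r₁) (hv₂ : v ∈ sector g₂ r₂) (hn : v ∈ A.wt n)
    (hpos : (0 : ℚ) < n + (r₁ : ℚ) / orderOf g₁) {w₁ : W₁} {w₂ : W₂}
    (h₁ : ∀ i : ℕ, 0 < i → ∀ h, F h 0 (M₁.Y v (-1 - (r₁ : ℚ) / orderOf g₁ + i) w₁) w₂ ∈ K)
    (h₂ : ∀ (i : ℕ) h, F h 0 w₁ (M₂.Y v (-((r₂ : ℚ) / orderOf g₂) + i) w₂) ∈ K) (h : ℂ) :
    F h 0 (M₁.Y v (-1 - (r₁ : ℚ) / orderOf g₁) w₁) w₂ ∈ K := by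
  have hr₂0 : (0 : ℚ) ≤ (r₂ : ℚ) / orderOf g₂ := by positivity
  set b : ℚ := -((r₂ : ℚ) / orderOf g₂) with hb
  -- With `n = -1` and `m = 0` the generator is the leading term on the right. The modes on `W₃`
  -- raise weight by `n + r₁/T₁ + r₂/T₂ + i > 0`, with `n` the weight of `v`, so `K` absorbs them.
  -- The shift `h - b` makes the leading exponent index `h`.
  have hJ := hF.jacobi r₁ hr₁ r₂ hr₂ v ⟨hv₁, hv₂⟩ w₁ w₂ (-1) 0
    (-1 - (r₁ : ℚ) / orderOf g₁) b (by push_cast; ring) (by push_cast; ring) (h - b) 0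
  obtain ⟨N, hN⟩ := M₁.exists_mode_add_eq_zero hr₁ hv₁ w₁ (-1 - (r₁ : ℚ) / orderOf g₁)
  have hfirst := mem_of_finsum_mem hJ.symm
    (K.sub_mem (finsum_mem_submodule fun i => K.smul_mem _ (hK n v _ hn ?_ _ _ _))
      (finsum_mem_submodule fun i => K.smul_mem _ (h₂ i _)))
    N (fun i hi => by rw [hN i hi]; simp) (fun i hi => K.smul_mem _ (h₁ i hi _))
  · simpa using hfirst
  · have : (0 : ℚ) ≤ i := Nat.cast_nonneg i
    linarith

/-- Reduction of a coefficient whose second argument is a generator of `C₁`, modulo a subspace `K`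
that absorbs the modes in question. -/
theorem mem_of_right_generator (hF : IsIntertwiningOperator M₁ M₂ M₃ F) {K : Submodule ℂ W₃}
    (hK : ∀ (n : ℤ) (v : V) (q : ℚ), v ∈ A.wt n → 0 < n - q - 1 → ∀ h w₁ w₂,
      M₃.Y v q (F h 0 w₁ w₂) ∈ K)
    {r₁ r₂ : ℕ} (hr₁ : r₁ < orderOf g₁) (hr₂ : r₂ < orderOf g₂) {n : ℤ} {v : V}
    (hv₁ : v ∈ sector g₁ r₁) (hv₂ : v ∈ sector g₂ r₂) (hn : v ∈ A.wt n)
    (hpos : (0 : ℚ) < n + (r₂ : ℚ) / orderOf g₂) {w₁ : W₁} {w₂ : W₂}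
    (h₁ : ∀ (i : ℕ) h, F h 0 (M₁.Y v (-((r₁ : ℚ) / orderOf g₁) + i) w₁) w₂ ∈ K)
    (h₂ : ∀ i : ℕ, 0 < i → ∀ h, F h 0 w₁ (M₂.Y v (-1 - (r₂ : ℚ) / orderOf g₂ + i) w₂) ∈ K)
    (h : ℂ) : F h 0 w₁ (M₂.Y v (-1 - (r₂ : ℚ) / orderOf g₂) w₂) ∈ K := by
  have hr₁0 : (0 : ℚ) ≤ (r₁ : ℚ) / orderOf g₁ := by positivity
  set a : ℚ := -((r₁ : ℚ) / orderOf g₁) with ha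
  -- With `n = 0` and `m = -1` the generator leads the second sum, up to a nonzero exponential
  -- factor.
  have hJ := hF.jacobi r₁ hr₁ r₂ hr₂ v ⟨hv₁, hv₂⟩ w₁ w₂ 0 (-1)
    a (-1 - (r₂ : ℚ) / orderOf g₂) (by push_cast; ring) (by push_cast; ring) (h - a) 0
  rw [sub_eq_iff_eq_add, ← sub_eq_iff_eq_add'] at hJ
  obtain ⟨N, hN⟩ := M₂.exists_mode_add_eq_zero hr₂ hv₂ w₂ (-1 - (r₂ : ℚ) / orderOf g₂)
  have hfirst := mem_of_finsum_mem hJ.symm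
    (K.sub_mem (finsum_mem_submodule fun i => K.smul_mem _ (hK n v _ hn ?_ _ _ _))
      (finsum_mem_submodule fun i => K.smul_mem _ (h₁ i _)))
    N (fun i hi => by rw [hN i hi]; simp) (fun i hi => K.smul_mem _ (h₂ i hi _))
  · rw [Submodule.smul_mem_iff _ (mul_ne_zero (by simp) (Complex.exp_ne_zero _))] at hfirst
    simpa using hfirst
  · have : (0 : ℚ) ≤ i := Nat.cast_nonneg i
    linarith

/-- An intertwining operator takes values in a subspace that absorbs the weight raising modes as
soon as it does so on homogeneous generators of the two modules modulo `C₁`. -/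
theorem mem_of_generators (hF : IsIntertwiningOperator M₁ M₂ M₃ F) (hg₁ : IsOfFinOrder g₁)
    (hg₂ : IsOfFinOrder g₂) (hg : Commute g₁ g₂) (hM₁ : M₁.IsGeneralized) (hM₂ : M₂.IsGeneralized)
    {K : Submodule ℂ W₃}
    (hK : ∀ (n : ℤ) (v : V) (q : ℚ), v ∈ A.wt n → 0 < n - q - 1 → ∀ h w₁ w₂,
      M₃.Y v q (F h 0 w₁ w₂) ∈ K)
    {ι₁ ι₂ : Type*} {b₁ : ι₁ → W₁} {b₂ : ι₂ → W₂}
    (hb₁ : ∀ μ, M₁.weightSpace μ ≤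
      Submodule.span ℂ (Set.range b₁ ∩ M₁.weightSpace μ ∪ M₁.c₁Generators μ))
    (hb₂ : ∀ μ, M₂.weightSpace μ ≤
      Submodule.span ℂ (Set.range b₂ ∩ M₂.weightSpace μ ∪ M₂.c₁Generators μ))
    (hb : ∀ i j h, F h 0 (b₁ i) (b₂ j) ∈ K) (h : ℂ) (w₁ : W₁) (w₂ : W₂) : F h 0 w₁ w₂ ∈ K := by
  refine hM₁.induction (P := K.comap ((F h 0).flip w₂)) (fun μ₁ w₁ hw₁ => ?_) w₁
  refine hM₂.induction (P := K.comap (F h 0 w₁)) (fun μ₂ w₂ hw₂ => ?_) w₂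
  rw [Submodule.mem_comap]
  have hT₁ : (0 : ℤ) < orderOf g₁ := Int.natCast_pos.2 hg₁.orderOf_pos
  have hT₂ : (0 : ℤ) < orderOf g₂ := Int.natCast_pos.2 hg₂.orderOf_pos
  have hTC₁ : (orderOf g₁ : ℂ) ≠ 0 := Nat.cast_ne_zero.2 hg₁.orderOf_pos.ne'
  have hTC₂ : (orderOf g₂ : ℂ) ≠ 0 := Nat.cast_ne_zero.2 hg₂.orderOf_pos.ne'
  set T₁ := orderOf g₁ with hT₁def
  set T₂ := orderOf g₂ with hT₂def
  obtain ⟨N₁, hN₁⟩ := hM₁.2 μ₁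
  obtain ⟨N₂, hN₂⟩ := hM₂.2 μ₂
  -- Induction is on `n₁ T₂ + n₂ T₁`, which is `T₁ T₂` times the total weight relative to `μ₁ + μ₂`.
  let Q : ℤ → ℤ → Prop := fun n₁ n₂ => ∀ w₁ ∈ M₁.weightSpace (μ₁ + n₁ / T₁),
    ∀ w₂ ∈ M₂.weightSpace (μ₂ + n₂ / T₂), ∀ h, F h 0 w₁ w₂ ∈ K
  have step : ∀ n₁ n₂ : ℤ, (∀ m₁ m₂ : ℤ, m₁ * T₂ + m₂ * T₁ < n₁ * T₂ + n₂ * T₁ → Q m₁ m₂) →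
      Q n₁ n₂ := by
    intro n₁ n₂ ih w₁ hw₁ w₂ hw₂ h
    suffices hle : Submodule.span ℂ (Set.range b₂ ∩ M₂.weightSpace (μ₂ + n₂ / T₂) ∪
        M₂.c₁Generators (μ₂ + n₂ / T₂)) ≤ K.comap (F h 0 w₁) from hle (hb₂ _ hw₂)
    refine Submodule.span_le.2 ?_
    rintro _ (⟨⟨j, rfl⟩, hj⟩ | ⟨r₂, hr₂, v, hv₂, n, hn, hpos, u, hu, rfl⟩)
    · suffices hle : Submodule.span ℂ (Set.range b₁ ∩ M₁.weightSpace (μ₁ + n₁ / T₁) ∪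
          M₁.c₁Generators (μ₁ + n₁ / T₁)) ≤ K.comap ((F h 0).flip (b₂ j)) from hle (hb₁ _ hw₁)
      refine Submodule.span_le.2 ?_
      rintro _ (⟨⟨i, rfl⟩, -⟩ | ⟨r₁, hr₁, v, hv₁, n, hn, hpos, u, hu, rfl⟩)
      · exact hb i j h
      -- The Jacobi identity needs a simultaneous eigenvector; `g₂` preserves `sector g₁ r₁` and the
      -- weight, so `v` can be decomposed inside both.
      · suffices hle : sector g₁ r₁ ⊓ A.wt n ≤ K.comap (((F h 0).flip (b₂ j)).comp
            ((LinearMap.applyₗ u).comp ((LinearMap.proj (-1 - (r₁ : ℚ) / T₁)).comp M₁.Y))) from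
          hle ⟨hv₁, hn⟩
        refine sector_induction hg₂ (fun v hv => ⟨map_mem_sector hg hv.1, map_mem_wt g₂ hv.2⟩)
          fun r₂ hr₂ v hv hv₂ => ?_
        refine hF.mem_of_left_generator hK hr₁ hr₂ hv.1 hv₂ hv.2 hpos
          (fun i hi h => ?_) (fun i h => ?_) h
        · refine ih (n₁ - i * T₁) n₂ ?_ _ ?_ _ hj h
          · have : (0 : ℤ) < i := Int.natCast_pos.2 hi
            have := mul_pos (mul_pos this hT₁) hT₂
            linarith
          · refine M₁.mode_mem_weightSpace hg₁ hv.2 _ ?_ hu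
            push_cast
            field_simp
            ring
        -- Total weight changes by `-r₁/T₁ + r₂/T₂ - 1 - i`, negative because `r₂ < T₂`.
        · refine ih (n₁ - n * T₁ - r₁) (n₂ + n * T₂ + r₂ - (i + 1) * T₂) ?_ _ ?_ _ ?_ h
          · have h1 : (0 : ℤ) ≤ i := Int.natCast_nonneg i
            have h2 : (0 : ℤ) < T₂ - r₂ := by omega
            have h3 := mul_pos h2 hT₁
            have h4 : (0 : ℤ) ≤ r₁ * T₂ := by positivity
            have h5 := mul_nonneg (mul_nonneg h1 hT₁.le) hT₂.le
            linarith
          · convert hu using 2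
            push_cast
            rw [← hT₁def]
            field_simp
            ring
          · refine M₂.mode_mem_weightSpace hg₂ hv.2 _ ?_ hj
            push_cast
            rw [← hT₂def]
            field_simp
            ring
    · suffices hle : sector g₂ r₂ ⊓ A.wt n ≤ K.comap ((F h 0 w₁).comp
          ((LinearMap.applyₗ u).comp ((LinearMap.proj (-1 - (r₂ : ℚ) / T₂)).comp M₂.Y))) from
        hle ⟨hv₂, hn⟩
      refine sector_induction hg₁ (fun v hv => ⟨map_mem_sector hg.symm hv.1, map_mem_wt g₁ hv.2⟩)
        fun r₁ hr₁ v hv hv₁ => ?_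
      refine hF.mem_of_right_generator hK hr₁ hr₂ hv₁ hv.1 hv.2 hpos
        (fun i h => ?_) (fun i hi h => ?_) h
      · refine ih (n₁ + n * T₁ + r₁ - (i + 1) * T₁) (n₂ - n * T₂ - r₂) ?_ _ ?_ _ ?_ h
        · have h1 : (0 : ℤ) ≤ i := Int.natCast_nonneg i
          have h2 : (0 : ℤ) < T₁ - r₁ := by omega
          have h3 := mul_pos h2 hT₂
          have h4 : (0 : ℤ) ≤ r₂ * T₁ := by positivity
          have h5 := mul_nonneg (mul_nonneg h1 hT₁.le) hT₂.le
          linarith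
        · refine M₁.mode_mem_weightSpace hg₁ hv.2 _ ?_ hw₁
          push_cast
          rw [← hT₁def]
          field_simp
          ring
        · convert hu using 2
          push_cast
          rw [← hT₂def]
          field_simp
          ring
      · refine ih n₁ (n₂ - i * T₂) ?_ _ hw₁ _ ?_ h
        · have : (0 : ℤ) < i := Int.natCast_pos.2 hi
          have := mul_pos (mul_pos this hT₁) hT₂
          linarith
        · refine M₂.mode_mem_weightSpace hg₂ hv.2 _ ?_ hu
          push_cast
          field_simp
          ring
  -- Below `N₁ T₂ + N₂ T₁` one has `n₁ ≤ N₁` or `n₂ ≤ N₂`, so one of the weight spaces is zero.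
  have key : ∀ (d : ℕ) (n₁ n₂ : ℤ), n₁ * T₂ + n₂ * T₁ < N₁ * T₂ + N₂ * T₁ + d → Q n₁ n₂ := by
    intro d
    induction d with
    | zero =>
      intro n₁ n₂ hlt w₁ hw₁ w₂ hw₂ h
      rcases le_or_gt n₁ N₁ with h1 | h1
      · rw [hN₁ n₁ h1, Submodule.mem_bot] at hw₁
        simp [hw₁]
      rcases le_or_gt n₂ N₂ with h2 | h2
      · rw [hN₂ n₂ h2, Submodule.mem_bot] at hw₂
        simp [hw₂]
      have h3 := mul_lt_mul_of_pos_right h1 hT₂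
      have h4 := mul_lt_mul_of_pos_right h2 hT₁
      push_cast at hlt
      linarith
    | succ d ihd =>
      intro n₁ n₂ hlt
      refine step n₁ n₂ fun m₁ m₂ hm => ihd m₁ m₂ ?_
      push_cast at hlt
      linarith
  refine key (0 * T₂ + 0 * T₁ - (N₁ * T₂ + N₂ * T₁) + 1 : ℤ).toNat 0 0 ?_ w₁ (by simpa using hw₁)
    w₂ (by simpa using hw₂) h
  have := Int.self_le_toNat (0 * T₂ + 0 * T₁ - (N₁ * T₂ + N₂ * T₁) + 1 : ℤ)
  linarith

/-- The derivative property expresses `k + 1` times a coefficient of `(log x)^(k+1)` through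
coefficients of `(log x)^k`. -/
theorem mem_of_forall_mem_zero (hF : IsIntertwiningOperator M₁ M₂ M₃ F) {K : Submodule ℂ W₃}
    (hK : ∀ h w₁ w₂, F h 0 w₁ w₂ ∈ K) (k : ℕ) : ∀ h w₁ w₂, F h k w₁ w₂ ∈ K := by
  induction k with
  | zero => exact hK
  | succ k ih =>
    intro h w₁ w₂
    have hd := hF.derivative w₁ w₂ (h + 1) k
    rw [add_sub_cancel_right] at hd
    have hk : (k : ℂ) + 1 ≠ 0 := Nat.cast_add_one_ne_zero k
    rw [← Submodule.smul_mem_iff K hk, ← sub_eq_iff_eq_add'.2 hd]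
    exact K.sub_mem (ih _ _ _) (K.smul_mem _ (ih _ _ _))

end IsIntertwiningOperator

/-! ### One step of a composition series -/

variable (M₁ M₂ M₃) in
/-- The intertwining operators with values in a subspace of `W₃`. -/
def intertwiningOperatorsInto (S : Submodule ℂ W₃) :
    Submodule ℂ (ℂ → ℕ → W₁ →ₗ[ℂ] W₂ →ₗ[ℂ] W₃) where
  carrier := {F | F ∈ intertwiningOperators M₁ M₂ M₃ ∧ ∀ h k w₁ w₂, F h k w₁ w₂ ∈ S}
  zero_mem' := ⟨Submodule.zero_mem _, fun _ _ _ _ => S.zero_mem⟩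
  add_mem' := fun ha hb => ⟨Submodule.add_mem _ ha.1 hb.1,
    fun h k w₁ w₂ => S.add_mem (ha.2 h k w₁ w₂) (hb.2 h k w₁ w₂)⟩
  smul_mem' := fun c _ ha => ⟨Submodule.smul_mem _ c ha.1,
    fun h k w₁ w₂ => S.smul_mem c (ha.2 h k w₁ w₂)⟩

theorem intertwiningOperatorsInto_top :
    intertwiningOperatorsInto M₁ M₂ M₃ ⊤ = intertwiningOperators M₁ M₂ M₃ :=
  le_antisymm (fun _ hF => hF.1) fun _ hF => ⟨hF, fun _ _ _ _ => Submodule.mem_top⟩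

theorem intertwiningOperatorsInto_bot : intertwiningOperatorsInto M₁ M₂ M₃ ⊥ = ⊥ :=
  eq_bot_iff.2 fun _ hF => (Submodule.mem_bot ℂ).2 <| funext fun h => funext fun k =>
    LinearMap.ext fun w₁ => LinearMap.ext fun w₂ => (Submodule.mem_bot ℂ).1 (hF.2 h k w₁ w₂)

/-- If the submodule `S'` covers the submodule `S`, then an intertwining operator with values in
`S'` is determined modulo those with values in `S` by one coordinate of its values on generators. -/
theorem exists_inf_ker_le_intertwiningOperatorsInto (hg₁ : IsOfFinOrder g₁)
    (hg₂ : IsOfFinOrder g₂) (hg : Commute g₁ g₂) (hM₁ : M₁.IsGeneralized) (hM₂ : M₂.IsGeneralized)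
    (hM₃ : M₃.IsGeneralized) (hC₁ : M₁.IsC₁Cofinite) (hC₂ : M₂.IsC₁Cofinite)
    {S S' : {S : Submodule ℂ W₃ // M₃.IsSubmodule S}} (hS : S ⋖ S') :
    ∃ Φ : (ℂ → ℕ → W₁ →ₗ[ℂ] W₂ →ₗ[ℂ] W₃) →ₗ[ℂ]
        (Fin (finrank ℂ (W₁ ⧸ M₁.C₁)) × Fin (finrank ℂ (W₂ ⧸ M₂.C₁)) → ℂ),
      intertwiningOperatorsInto M₁ M₂ M₃ S'.1 ⊓ LinearMap.ker Φ ≤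
        intertwiningOperatorsInto M₁ M₂ M₃ S.1 := by
  obtain ⟨b₁, wt₁, hwt₁, hb₁⟩ := hM₁.exists_homogeneous_generators hg₁ hC₁
  obtain ⟨b₂, wt₂, hwt₂, hb₂⟩ := hM₂.exists_homogeneous_generators hg₂ hC₂
  obtain ⟨φ, μ, hφS, hφS', hφμ, hφ⟩ := hM₃.exists_lowest_functional
    (hg.isOfFinOrder_mul hg₁ hg₂) S.2 S'.2 hS.lt.not_ge
  let Φ : (ℂ → ℕ → W₁ →ₗ[ℂ] W₂ →ₗ[ℂ] W₃) →ₗ[ℂ]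
      (Fin (finrank ℂ (W₁ ⧸ M₁.C₁)) × Fin (finrank ℂ (W₂ ⧸ M₂.C₁)) → ℂ) :=
    -- The only exponent at which the value on this pair has weight `μ`, the one weight that `φ`
    -- detects.
    { toFun := fun F p => φ (F (wt₁ p.1 + wt₂ p.2 - μ - 1) 0 (b₁ p.1) (b₂ p.2))
      map_add' := fun F G => by
        ext p
        simp
      map_smul' := fun c F => by
        ext p
        simp }
  refine ⟨Φ, fun F ⟨⟨hF, hFS'⟩, hFΦ⟩ => ⟨hF, ?_⟩⟩
  have hF' : IsIntertwiningOperator M₁ M₂ M₃ F := hF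
  have hbase : ∀ i j h, F h 0 (b₁ i) (b₂ j) ∈ LinearMap.ker φ := by
    intro i j h
    by_cases hh : wt₁ i + wt₂ j - h - 1 = μ
    · have := congrFun (LinearMap.mem_ker.1 hFΦ) (i, j)
      rw [show h = wt₁ i + wt₂ j - μ - 1 by rw [← hh]; ring]
      exact this
    · exact hφμ _ hh (hF'.apply_mem_weightSpace hg₁ hg₂ (hwt₁ i) (hwt₂ j) h 0)
  have hker := hF'.mem_of_forall_mem_zero (hF'.mem_of_generators hg₁ hg₂ hg hM₁ hM₂
    (fun n v q hv hpos h w₁ w₂ => hφ n v q hv hpos _ (hFS' h 0 w₁ w₂)) hb₁ hb₂ hbase)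
  set I := Submodule.span ℂ {x | ∃ h k w₁ w₂, x = F h k w₁ w₂}
  have hI : M₃.IsSubmodule (S.1 ⊔ I) := by
    intro v q w hw
    obtain ⟨x, hx, y, hy, rfl⟩ := Submodule.mem_sup.1 hw
    rw [map_add]
    exact Submodule.add_mem_sup (S.2 v q x hx) (hF'.isSubmodule_span hg₁ hg₂ hg v q y hy)
  have hIφ : S.1 ⊔ I ≤ LinearMap.ker φ := sup_le hφS (Submodule.span_le.2 (by
    rintro _ ⟨h, k, w₁, w₂, rfl⟩
    exact hker k h w₁ w₂))
  have hIS' : S.1 ⊔ I ≤ S'.1 := sup_le hS.le (Submodule.span_le.2 (by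
    rintro _ ⟨h, k, w₁, w₂, rfl⟩
    exact hFS' h k w₁ w₂))
  -- By covering, `S ⊔ I` is `S` or `S'`; the latter is excluded since `φ` kills `S ⊔ I` but not
  -- `S'`.
  rcases hS.eq_or_eq (c := ⟨S.1 ⊔ I, hI⟩) (le_sup_left (a := S.1) (b := I)) hIS' with heq | heq
  · intro h k w₁ w₂
    rw [← heq]
    exact Submodule.mem_sup_right (Submodule.subset_span ⟨h, k, w₁, w₂, rfl⟩)
  · rw [← heq] at hφS'
    exact absurd hIφ hφS'

theorem WeakTwistedModule.IsSimple.bot_covBy_top (hM : M₃.IsSimple) (hbot : M₃.IsSubmodule ⊥)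
    (htop : M₃.IsSubmodule ⊤) :
    (⟨⊥, hbot⟩ : {S : Submodule ℂ W₃ // M₃.IsSubmodule S}) ⋖ ⟨⊤, htop⟩ := by
  have := hM.1
  refine ⟨Subtype.mk_lt_mk.2 bot_lt_top, fun S h₁ h₂ => ?_⟩
  rcases hM.2 S.1 S.2 with h | h
  · exact h₁.ne (Subtype.ext h.symm)
  · exact h₂.ne (Subtype.ext h)

end Intertwining

end

/-! ### Induction along the composition series -/

theorem mainTheorem2 {V : Type*} [AddCommGroup V] [Module ℂ V] (A : VertexOperatorAlgebra V)
    (g₁ g₂ : A.Aut) (hg₁ : IsOfFinOrder g₁) (hg₂ : IsOfFinOrder g₂) (hg : Commute g₁ g₂)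
    {W₁ W₂ W₃ : Type*} [AddCommGroup W₁] [Module ℂ W₁] [AddCommGroup W₂] [Module ℂ W₂]
    [AddCommGroup W₃] [Module ℂ W₃]
    (M₁ : WeakTwistedModule A g₁ W₁) (M₂ : WeakTwistedModule A g₂ W₂)
    (M₃ : WeakTwistedModule A (g₁ * g₂) W₃)
    (hM₁ : M₁.IsGeneralized) (hM₂ : M₂.IsGeneralized) (hM₃ : M₃.IsGeneralized)
    (hC₁ : M₁.IsC₁Cofinite) (hC₂ : M₂.IsC₁Cofinite) (hlen : M₃.HasFiniteLength) :
    FiniteDimensional ℂ (intertwiningOperators M₁ M₂ M₃) ∧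
      (M₃.IsSimple → Module.finrank ℂ (intertwiningOperators M₁ M₂ M₃) ≤
        Module.finrank ℂ (W₁ ⧸ M₁.C₁) * Module.finrank ℂ (W₂ ⧸ M₂.C₁)) := by
  constructor
  · obtain ⟨n, S, hS0, hSn, hcov⟩ := hlen
    rw [← intertwiningOperatorsInto_top, ← hSn]
    have key : ∀ i : Fin (n + 1),
        FiniteDimensional ℂ (intertwiningOperatorsInto M₁ M₂ M₃ (S i).1) := by
      intro i
      induction i using Fin.induction with
      | zero =>
        rw [hS0, intertwiningOperatorsInto_bot]
        infer_instance
      | succ i ih =>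
        obtain ⟨Φ, hΦ⟩ := exists_inf_ker_le_intertwiningOperatorsInto hg₁ hg₂ hg hM₁ hM₂ hM₃ hC₁ hC₂
          (hcov i)
        -- The image under `Φ` lies in a finite-dimensional space, and the part killed by `Φ` lies
        -- in the space of the previous step.
        refine Module.Finite.iff_fg.2 (Submodule.fg_of_fg_map_of_fg_inf_ker Φ
          (IsNoetherian.noetherian _) (Module.Finite.iff_fg.1 ?_))
        exact Submodule.finiteDimensional_of_le hΦ
    exact key (Fin.last n)
  · intro hsimple
    obtain ⟨Φ, hΦ⟩ := exists_inf_ker_le_intertwiningOperatorsInto hg₁ hg₂ hg hM₁ hM₂ hM₃ hC₁ hC₂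
      (hsimple.bot_covBy_top (fun v q w hw => by simp [(Submodule.mem_bot ℂ).1 hw])
        fun _ _ _ _ => Submodule.mem_top)
    rw [intertwiningOperatorsInto_top, intertwiningOperatorsInto_bot, le_bot_iff] at hΦ
    have hinj : Function.Injective (Φ.domRestrict (intertwiningOperators M₁ M₂ M₃)) := by
      refine (injective_iff_map_eq_zero _).2 fun F hF => ?_
      have hF0 : F.1 ∈ (⊥ : Submodule ℂ _) := hΦ ▸ ⟨F.2, hF⟩
      exact Subtype.ext ((Submodule.mem_bot ℂ).1 hF0)
    simpa using LinearMap.finrank_le_finrank_of_injective hinj
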